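/- Let $m,p,q\in\mathbb N$, $\sigma\ge 0$, and let $\|\cdot\|$ be the Euclidean norm. **System class.** Let $d\in L^\infty(\mathbb R_{\ge0},\mathbb R^p)$. Let $\mathbf T:C([-\sigma,\infty),\mathbb R^m)\to L^\infty_{\rm loc}(\mathbb R_{\ge0},\mathbb R^q)$ be an operator such that: * (causality) for all $y_1,y_2$ and $t\ge0$: if $y_1|_{[-\sigma,t]}=y_2|_{[-\sigma,t]}$, then $\mathbf T(y_1)|_{[0,t]}=\mathbf T(y_2)|_{[0,t]}$; * (local Lipschitz) for all $t\ge 0$ and $y\in C([-\sigma,t],\mathbb R^m)$ there are $\Delta,\delta,c>0$ such that for all $y_1,y_2\in C([-\sigma,\infty),\mathbb R^m)$ with $y_i|_{[-\sigma,t]}=y$ and $\|y_i(s)-y(t)\|<\delta$ for $s\in[t,t+\Delta]$, $i=1,2$, $$\operatorname*{ess\,sup}_{s\in[t,t+\Delta]}\|\mathbf T(y_1)(s)-\mathbf T(y_2)(s)\|\le c\sup_{s\in[t,t+\Delta]}\|y_1(s)-y_2(s)\|;$$ * (bounded input, bounded output) for every $c_0>0$ there is $c_1>0$ such that $\sup_{t\ge-\sigma}\|y(t)\|\le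 c_0$ implies $\|\mathbf T(y)(t)\|\le c_1$ for almost all $t\ge0$. Let $F\in C(\mathbb R^p\times\mathbb R^q\times\mathbb R^m,\mathbb R^m)$ have the perturbation high-gain property: for every compact $K_m\subset\mathbb R^m$ there is $\nu\in(0,1)$ such that for all compact $K_p\subset\mathbb R^p$, $K_q\subset\mathbb R^q$ the function $$\chi(s)=\min\{\langle v,F(\delta,z,\Delta-sv)\rangle : \delta\in K_p,\ z\in K_q,\ \Delta\in K_m,\ \nu\le\|v\|\le1\}$$ satisfies $\sup_{s\in\mathbb R}\chi(s)=\infty$. **Data.** Let $y^0\in C([-\sigma,0],\mathbb R^m)$, $D\in L^\infty(\mathbb R_{\ge0},\mathbb R^m)$, let $N\in C(\mathbb R_{\ge0},\mathbb R)$ be surjective, let $\alpha\in C([0,1),[1,\infty))$ be bijective, and let $\beta\in C([0,1],[0,\beta^+])$, $\beta^+>0$, satisfy $\beta(1)>0$. Let $\rho\in W^{1,\infty}(\mathbb R_{\ge0},\mathbb R^m)$ and $\varphi\in W^{1,\infty}(\mathbb R_{\ge0},\mathbb R)$ (continuous representatives) with $\inf_{t\ge0}\varphi(t)>0$ and $\|y^0(0)-\rho(0)\|<\varphi(0)$.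 **Closed loop.** Consider $$\dot y(t)=F\big(d(t),\mathbf T(y)(t),D(t)+u(t)\big),\quad y|_{[-\sigma,0]}=y^0,\qquad u(t)=\beta(\|w(t)\|)\,(N\circ\alpha)(\|w(t)\|^2)\,w(t),\quad w(t)=\frac{y(t)-\rho(t)}{\varphi(t)}.$$ A solution is a function $y:[-\sigma,\omega)\to\mathbb R^m$, $0<\omega\le\infty$, with $y|_{[-\sigma,0]}=y^0$ that is absolutely continuous on the compact subintervals of $[0,\omega)$ and such that for almost all $t\in[0,\omega)$ one has $\|w(t)\|<1$ (so that $u(t)$ is defined) and the differential equation holds at $t$; here $\mathbf T(y)$ is defined on $[0,\omega)$ through causality. A solution is maximal if it has no proper right extension that is also a solution. **Claim.** The closed-loop initial value problem has a solution, every solution can be extended to a maximal solution, and every maximal solution $y:[-\sigma,\omega)\to\mathbb R^m$ satisfies: 1. $\omega=\infty$; 2. all signals are bounded: $y\in L^\infty([-\sigma,\infty),\mathbb R^m)$, $\dot y,u\in L^\infty(\mathbb R_{\ge0},\mathbb R^m)$, $\mathbf T(y)\in L^\infty(\mathbb R_{\ge0},\mathbb R^q)$, and $\alpha(\|w\|^2),\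 (N\circ\alpha)(\|w\|^2)\in L^\infty(\mathbb R_{\ge0},\mathbb R)$; 3. $\|y(t)-\rho(t)\|<\varphi(t)$ for all $t\ge0$. -/

import Mathlib

open MeasureTheory Set

namespace FunnelControl

/-- `ℝⁿ` with the Euclidean norm. -/
abbrev E (n : ℕ) : Type := EuclideanSpace ℝ (Fin n)

/-- Lebesgue measure on `[0, ∞)`. -/
noncomputable abbrev volPos : Measure ℝ := volume.restrict (Ici (0 : ℝ))

/-- `g` is a weak derivative of `f` on `(0, ∞)`: integration by parts holds against every smooth
scalar test function with compact support in `(0, ∞)`. -/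
def IsWeakDeriv {V : Type*} [NormedAddCommGroup V] [NormedSpace ℝ V] (f g : ℝ → V) : Prop :=
  ∀ ψ : ℝ → ℝ, ContDiff ℝ (⊤ : ℕ∞) ψ → HasCompactSupport ψ → tsupport ψ ⊆ Ioi 0 →
    ∫ t in Ioi (0 : ℝ), deriv ψ t • f t = - ∫ t in Ioi (0 : ℝ), ψ t • g t

/-- `f ∈ W^{1,∞}([0, ∞), V)`: both `f` and its weak derivative are essentially bounded. As usual
an element of this space is identified with its continuous representative, so that its values
at single points make sense. Values of `f` at negative arguments are irrelevant. -/
structure MemW1Inf {V : Type*} [NormedAddCommGroup V] [NormedSpace ℝ V] (f : ℝ → V) :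
    Prop where
  continuousOn : ContinuousOn f (Ici 0)
  memLp : MemLp f ⊤ volPos
  exists_weakDeriv : ∃ g : ℝ → V, MemLp g ⊤ volPos ∧ IsWeakDeriv f g

/-- The set `𝒢` of funnel functions: scalar `φ ∈ W^{1,∞}([0, ∞), ℝ)` with `inf_{t ≥ 0} φ t > 0`. -/
structure IsFunnelFunction (φ : ℝ → ℝ) : Prop where
  memW1Inf : MemW1Inf φ
  inf_pos : 0 < sInf (φ '' Ici 0)

/-- The properties of an operator `T : C([-σ, ∞), ℝᵐ) → L^∞_loc([0, ∞), ℝ^q)`.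
Here `T` is applied to functions on `ℝ` that are continuous on `[-σ, ∞)`, and by causality `T y`
depends (up to null sets) only on the restriction of `y` to `[-σ, ∞)`. All statements about
values of `T y` are up to null sets and concern nonnegative times only. -/
structure IsAdmissibleOperator {m q : ℕ} (σ : ℝ) (T : (ℝ → E m) → ℝ → E q) : Prop where
  /-- `T y` is in `L^∞_loc([0, ∞), ℝ^q)`. -/
  memLp_loc : ∀ y : ℝ → E m, ContinuousOn y (Ici (-σ)) →
    ∀ t : ℝ, 0 ≤ t → MemLp (T y) ⊤ (volume.restrict (Icc 0 t))
  causal : ∀ y₁ y₂ : ℝ → E m, ContinuousOn y₁ (Ici (-σ)) → ContinuousOn y₂ (Ici (-σ)) →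
    ∀ t : ℝ, 0 ≤ t → EqOn y₁ y₂ (Icc (-σ) t) → T y₁ =ᵐ[volume.restrict (Icc 0 t)] T y₂
  locally_lipschitz : ∀ t : ℝ, 0 ≤ t → ∀ y : ℝ → E m, ContinuousOn y (Icc (-σ) t) →
    ∃ Δ δ c : ℝ, 0 < Δ ∧ 0 < δ ∧ 0 < c ∧
      ∀ y₁ y₂ : ℝ → E m, ContinuousOn y₁ (Ici (-σ)) → ContinuousOn y₂ (Ici (-σ)) →
        EqOn y₁ y (Icc (-σ) t) → EqOn y₂ y (Icc (-σ) t) →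
        (∀ s ∈ Icc t (t + Δ), ‖y₁ s - y t‖ < δ) → (∀ s ∈ Icc t (t + Δ), ‖y₂ s - y t‖ < δ) →
        eLpNorm (fun s => T y₁ s - T y₂ s) ⊤ (volume.restrict (Icc t (t + Δ)))
          ≤ ENNReal.ofReal c * ⨆ s ∈ Icc t (t + Δ), ‖y₁ s - y₂ s‖ₑ
  /-- Bounded input, bounded output. -/
  bibo : ∀ c₀ : ℝ, 0 < c₀ → ∃ c₁ : ℝ, 0 < c₁ ∧
    ∀ y : ℝ → E m, ContinuousOn y (Ici (-σ)) → (∀ t ∈ Ici (-σ), ‖y t‖ ≤ c₀) →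
      ∀ᵐ t ∂volPos, ‖T y t‖ ≤ c₁

/-- The function `χ(s) = min ⟨v, F(δ, z, Δ - s v)⟩` over `δ ∈ Kp`, `z ∈ Kq`, `Δ ∈ Km` and
`ν ≤ ‖v‖ ≤ 1`. It is written as an infimum in the extended reals, which is the minimum when the
compact index set is nonempty. -/
noncomputable def gainMin {p q m : ℕ} (F : E p × E q × E m → E m) (ν : ℝ)
    (Kp : Set (E p)) (Kq : Set (E q)) (Km : Set (E m)) (s : ℝ) : EReal :=
  ⨅ (δ ∈ Kp) (z ∈ Kq) (Δ ∈ Km) (v : E m) (_ : ν ≤ ‖v‖ ∧ ‖v‖ ≤ 1),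
    ((inner ℝ v (F (δ, z, Δ - s • v)) : ℝ) : EReal)

/-- The perturbation high-gain property. -/
def PerturbationHighGain {p q m : ℕ} (F : E p × E q × E m → E m) : Prop :=
  ∀ Km : Set (E m), IsCompact Km → ∃ ν ∈ Ioo (0 : ℝ) 1,
    ∀ (Kp : Set (E p)) (Kq : Set (E q)), IsCompact Kp → IsCompact Kq →
      ⨆ s : ℝ, gainMin F ν Kp Kq Km s = ⊤

/-- The system class `𝒩ᵐ`: `(d, F, T) ∈ 𝒩ᵐ` with dimensions `p`, `q` and memory `σ ≥ 0`. -/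
structure SystemClass {p q m : ℕ} (σ : ℝ) (d : ℝ → E p) (F : E p × E q × E m → E m)
    (T : (ℝ → E m) → ℝ → E q) : Prop where
  memory_nonneg : 0 ≤ σ
  disturbance : MemLp d ⊤ volPos
  operator : IsAdmissibleOperator σ T
  continuous : Continuous F
  highGain : PerturbationHighGain F

/-- `y : [-σ, ω) → ℝᵐ`, `0 < ω ≤ ∞`, is a Carathéodory solution of
`y'(t) = F(d(t), T(y)(t), v(t))`, `y|_[-σ,0] = y⁰`.
Only the values of `y` on `[-σ, ω)` matter. For `t ≤ τ < ω`, `T(y)(t)` is the value at `t` of `T` at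
any continuous extension `Y` of `y|_[-σ,τ]` to `[-σ, ∞)`; by causality of `T` the choice of `Y` is
irrelevant. -/
structure IsSolution {p q m : ℕ} (σ : ℝ) (d : ℝ → E p) (F : E p × E q × E m → E m)
    (T : (ℝ → E m) → ℝ → E q) (y₀ : ℝ → E m) (v : ℝ → E m) (ω : EReal) (y : ℝ → E m) :
    Prop where
  pos : 0 < ω
  initial : EqOn y y₀ (Icc (-σ) 0)
  absCont : ∀ τ : ℝ, 0 < τ → (τ : EReal) < ω → AbsolutelyContinuousOnInterval y 0 τ
  equation : ∀ τ : ℝ, 0 < τ → (τ : EReal) < ω →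
    ∀ Y : ℝ → E m, ContinuousOn Y (Ici (-σ)) → EqOn Y y (Icc (-σ) τ) →
      ∀ᵐ t ∂volume.restrict (Icc 0 τ), HasDerivAt y (F (d t, T Y t, v t)) t

/-- The scaled funnel feedback `w ↦ β(‖w‖) (N ∘ α)(‖w‖²) w`, evaluated at the normalized error
`w = e / φ`. It is meaningful for `‖w‖ < 1`. -/
noncomputable def feedback {m : ℕ} (β N α : ℝ → ℝ) (w : E m) : E m :=
  (β ‖w‖ * N (α (‖w‖ ^ 2))) • w

/-- The normalized error `t ↦ (y(t) - ρ(t)) / φ(t)`. -/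
noncomputable def normalizedError {m : ℕ} (ρ : ℝ → E m) (φ : ℝ → ℝ) (y : ℝ → E m) (t : ℝ) : E m :=
  (φ t)⁻¹ • (y t - ρ t)

/-- The signal `u` generated by the funnel control law along the output `y`. -/
noncomputable def funnelInput {m : ℕ} (β N α : ℝ → ℝ) (ρ : ℝ → E m) (φ : ℝ → ℝ) (y : ℝ → E m)
    (t : ℝ) : E m :=
  feedback β N α (normalizedError ρ φ y t)

/-- `y : [-σ, ω) → ℝᵐ` solves the closed-loop initial value problem
`y'(t) = F(d(t), T(y)(t), D(t) + u(t))`, `y|_[-σ,0] = y⁰`, where `u` is the funnel control signal.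
Since `α` is a function on `[0, 1)`, satisfying the equation for almost all `t` includes that the
normalized error has norm less than one, so that `u(t)` is defined, for almost all `t`. -/
structure IsClosedLoopSolution {p q m : ℕ} (σ : ℝ) (d : ℝ → E p) (F : E p × E q × E m → E m)
    (T : (ℝ → E m) → ℝ → E q) (y₀ : ℝ → E m) (D : ℝ → E m) (β N α : ℝ → ℝ) (ρ : ℝ → E m)
    (φ : ℝ → ℝ) (ω : EReal) (y : ℝ → E m) : Prop where
  defined : ∀ᵐ t : ℝ, 0 ≤ t → (t : EReal) < ω → ‖normalizedError ρ φ y t‖ < 1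
  solution : IsSolution σ d F T y₀ (fun t => D t + funnelInput β N α ρ φ y t) ω y

/-- A solution `y` on `[-σ, ω)` is maximal if no solution on a larger interval `[-σ, ω')` extends
it. -/
structure IsMaximalClosedLoopSolution {p q m : ℕ} (σ : ℝ) (d : ℝ → E p)
    (F : E p × E q × E m → E m) (T : (ℝ → E m) → ℝ → E q) (y₀ : ℝ → E m) (D : ℝ → E m)
    (β N α : ℝ → ℝ) (ρ : ℝ → E m) (φ : ℝ → ℝ) (ω : EReal) (y : ℝ → E m) : Prop where
  isSolution : IsClosedLoopSolution σ d F T y₀ D β N α ρ φ ω y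
  maximal : ∀ (ω' : EReal) (z : ℝ → E m), IsClosedLoopSolution σ d F T y₀ D β N α ρ φ ω' z →
    (∀ t : ℝ, -σ ≤ t → (t : EReal) < ω → z t = y t) → ω' ≤ ω

end FunnelControl

open FunnelControl

namespace FunnelControl

section Proofs

open Filter Topology Interval
open scoped NNReal ENNReal

/-! The heart is a barrier that holds for all solutions at once. Membership in the funnel almost
everywhere already gives `‖w‖ ≤ 1` everywhere by continuity, so `y` is bounded and, by the BIBO
property, `T(y)` takes values in a fixed compact set (`exists_operator_bound`). With these compact
sets fixed, the high-gain property supplies a number `s` for which `⟨v, F(δ, z, Δ - s v)⟩` exceeds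
any prescribed bound on `ν ≤ ‖v‖ ≤ 1`. Since `N` is surjective and `β(1) > 0`, the total gain `β(r)
N(α(r²))` takes the value `s` at some `r < 1` beyond both `ν` and the initial error
(`exists_gain_eq`). By compactness the estimate survives on a thin shell `r ≤ ‖w‖ < r + η`, and with
`v = -w` it says that the feedback pushes inwards there (`exists_repelling_shell`), faster than `ρ`
and `φ` can move. Hence `‖y - ρ‖ - rφ` never becomes positive (`exists_barrier`).

Below the barrier the feedback is bounded, so all solutions share one Lipschitz constant on
nonnegative times (`exists_lipschitz_bound`). A solution with finite end time therefore has a limit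
there, strictly inside the funnel, and can be restarted (`exists_extension`). Zorn's lemma provides
maximal solutions, which must then be global.

The restart, like the initial existence, is a Peano-type theorem for a functional differential
equation (`IsLocalProblem.exists_solution`): delayed equations are solved exactly in finitely many
steps, and Arzelà–Ascoli lets the delay tend to zero. The data in `W^{1,∞}` enter only through
continuity, bounds and Lipschitz constants, the last extracted from the weak derivative in
`MemW1Inf.exists_lipschitzOnWith`. -/

/-! ### Absolute continuity and almost-everywhere estimates -/

theorem _root_.AbsolutelyContinuousOnInterval.lipschitz_comp {X Y : Type*} [PseudoMetricSpace X]
    [PseudoMetricSpace Y] {f : ℝ → X} {g : X → Y} {K : ℝ≥0} {a b : ℝ} (hg : LipschitzWith K g)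
    (hf : AbsolutelyContinuousOnInterval f a b) :
    AbsolutelyContinuousOnInterval (fun t => g (f t)) a b := by
  refine squeeze_zero (fun t => Finset.sum_nonneg fun i _ => dist_nonneg) (fun t => ?_)
    (by simpa using Tendsto.const_mul (K : ℝ) hf)
  rw [Finset.mul_sum]
  exact Finset.sum_le_sum fun i _ => hg.dist_le_mul _ _

theorem _root_.AbsolutelyContinuousOnInterval.sub_le_of_ae_hasDerivAt_le {f : ℝ → ℝ} {a b C : ℝ}
    (hab : a ≤ b) (hf : AbsolutelyContinuousOnInterval f a b)
    (h : ∀ᵐ x, x ∈ Ioo a b → ∃ c ≤ C, HasDerivAt f c x) : f b - f a ≤ C * (b - a) := by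
  rw [← hf.integral_deriv_eq_sub]
  have h1 : ∫ x in a..b, deriv f x ≤ ∫ _ in a..b, C := by
    refine intervalIntegral.integral_mono_ae_restrict hab hf.intervalIntegrable_deriv
      intervalIntegrable_const ?_
    rw [← restrict_Ioo_eq_restrict_Icc]
    filter_upwards [(ae_restrict_iff' measurableSet_Ioo).2 h] with x hx
    obtain ⟨c, hc, hd⟩ := hx
    rw [hd.deriv]
    exact hc
  simpa [mul_comm] using h1

/-- Pairing with the increment `v = f b - f a` itself reduces the claim to the scalar case; dividing
by `‖v‖` finishes it. -/
theorem _root_.AbsolutelyContinuousOnInterval.norm_sub_le_of_ae_hasDerivAt {V : Type*}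
    [NormedAddCommGroup V] [InnerProductSpace ℝ V] {f : ℝ → V} {a b C : ℝ}
    (hab : a ≤ b) (hf : AbsolutelyContinuousOnInterval f a b)
    (h : ∀ᵐ x, x ∈ Ioo a b → ∃ c, ‖c‖ ≤ C ∧ HasDerivAt f c x) : ‖f b - f a‖ ≤ C * (b - a) := by
  set v := f b - f a with hv
  have hac : AbsolutelyContinuousOnInterval (fun t => innerSL ℝ v (f t)) a b :=
    hf.lipschitz_comp (innerSL ℝ v).lipschitz
  have key := hac.sub_le_of_ae_hasDerivAt_le (C := ‖v‖ * C) hab (by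
    filter_upwards [h] with x hx hx'
    obtain ⟨c, hc, hd⟩ := hx hx'
    refine ⟨innerSL ℝ v c, ?_, ?_⟩
    · rw [innerSL_apply_apply]
      exact (real_inner_le_norm _ _).trans (by gcongr)
    · exact (innerSL ℝ v).hasFDerivAt.comp_hasDerivAt x hd)
  rw [innerSL_apply_apply, innerSL_apply_apply, ← inner_sub_right, ← hv,
    real_inner_self_eq_norm_sq] at key
  rcases (norm_nonneg v).eq_or_lt with h0 | h0
  · rcases hab.eq_or_lt with rfl | hab
    · simp [hv]
    rw [← h0]
    -- When `v = 0` there is nothing to divide by, and `0 ≤ C` has to be read off from one point of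
    -- the interval where the bound holds.
    have : ∃ x ∈ Ioo a b, ∃ c, ‖c‖ ≤ C ∧ HasDerivAt f c x := by
      have hpos : (volume.restrict (Ioo a b)) ≠ 0 := by
        simp [Measure.restrict_eq_zero, hab]
      have : (ae (volume.restrict (Ioo a b))).NeBot := ae_neBot.2 hpos
      exact ((ae_restrict_iff' measurableSet_Ioo).2 h).and (ae_restrict_mem measurableSet_Ioo)
        |>.exists.imp fun x hx => ⟨hx.2, hx.1⟩
    obtain ⟨_, _, c, hc, _⟩ := this
    exact mul_nonneg ((norm_nonneg c).trans hc) (by linarith)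
  · have : ‖v‖ * ‖v‖ ≤ ‖v‖ * (C * (b - a)) := by nlinarith
    exact le_of_mul_le_mul_left this h0

theorem ae_norm_le_of_memLp_top {V : Type*} [NormedAddCommGroup V] {f : ℝ → V} {μ : Measure ℝ}
    (hf : MemLp f ⊤ μ) : ∃ C, 0 ≤ C ∧ ∀ᵐ t ∂μ, ‖f t‖ ≤ C := by
  refine ⟨(eLpNorm f ⊤ μ).toReal, ENNReal.toReal_nonneg, ?_⟩
  rw [eLpNorm_exponent_top]
  filter_upwards [ae_le_eLpNormEssSup (f := f) (μ := μ)] with t ht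
  rw [← toReal_enorm]
  exact ENNReal.toReal_mono (by simpa using hf.2.ne) ht

/-- The continuous functions `max f b` and `b` agree almost everywhere on `s`, hence everywhere on
it. -/
theorem le_on_of_ae_le {f b : ℝ → ℝ} {s : Set ℝ} (hs : s ⊆ closure (interior s))
    (hf : ContinuousOn f s) (hb : ContinuousOn b s)
    (h : ∀ᵐ t ∂(volume.restrict s), f t ≤ b t) : ∀ t ∈ s, f t ≤ b t := by
  have h1 : EqOn (fun t => max (f t) (b t)) b s := by
    refine Measure.eqOn_of_ae_eq (μ := volume) ?_ (hf.sup hb) hb hs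
    filter_upwards [h] with t ht using max_eq_right ht
  intro t ht
  rw [← h1 ht]
  exact le_max_left _ _

/-! ### Lipschitz continuity from a bounded weak derivative -/

theorem deriv_smoothTransition_eq_zero {u : ℝ} (hu : u ∉ Ioc (0 : ℝ) 1) :
    deriv Real.smoothTransition u = 0 := by
  have hmin : ∀ x, Real.smoothTransition x = 0 → deriv Real.smoothTransition x = 0 := fun x hx =>
    IsLocalMin.deriv_eq_zero (Eventually.of_forall fun y => hx ▸ Real.smoothTransition.nonneg y)
  have hmax : ∀ x, Real.smoothTransition x = 1 → deriv Real.smoothTransition x = 0 := fun x hx =>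
    IsLocalMax.deriv_eq_zero (Eventually.of_forall fun y => hx ▸ Real.smoothTransition.le_one y)
  rcases le_or_gt u 0 with h | h
  · exact hmin u (Real.smoothTransition.zero_of_nonpos h)
  · refine hmax u (Real.smoothTransition.one_of_one_le ?_)
    by_contra! h1
    exact hu ⟨h, h1.le⟩

theorem continuous_deriv_smoothTransition : Continuous (deriv Real.smoothTransition) :=
  (Real.smoothTransition.contDiff (n := 1)).continuous_deriv le_rfl

section WeakDeriv

variable {V : Type*} [NormedAddCommGroup V] [NormedSpace ℝ V]

/-- The substitution `x = c + ε u` turns the approximate delta at `c` into a fixed kernel on `[0,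
1]`. The right-hand side makes sense at `ε = 0`, which allows the later passage to the limit. -/
theorem setIntegral_scaled_bump {f : ℝ → V} {F : ℝ → V} (hF : Continuous F)
    (hfF : EqOn f F (Ici 0)) {c ε : ℝ} (hc : 0 < c) (hε : 0 < ε) :
    IntegrableOn (fun x => (deriv Real.smoothTransition ((x - c) / ε) * ε⁻¹) • f x) (Ioi 0) ∧
      ∫ x in Ioi (0 : ℝ), (deriv Real.smoothTransition ((x - c) / ε) * ε⁻¹) • f x
        = ∫ u in (0 : ℝ)..1, deriv Real.smoothTransition u • F (c + ε * u) := by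
  set K := deriv Real.smoothTransition with hK
  have hKc : Continuous K := continuous_deriv_smoothTransition
  set G : ℝ → V := fun x => (K ((x - c) / ε) * ε⁻¹) • F x with hG
  have hGc : Continuous G := by fun_prop
  have hG0 : ∀ x, x ∉ Icc c (c + ε) → G x = 0 := by
    intro x hx
    have : K ((x - c) / ε) = 0 := by
      refine deriv_smoothTransition_eq_zero fun h => hx ?_
      have h1 := h.1
      have h2 := h.2
      rw [div_le_one hε] at h2
      have h3 := (div_pos_iff_of_pos_right hε).1 h1
      constructor <;> linarith
    simp [hG, this]
  have hGi : Integrable G := hGc.integrable_of_hasCompactSupport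
    (HasCompactSupport.intro isCompact_Icc hG0)
  have hcong : EqOn (fun x => (K ((x - c) / ε) * ε⁻¹) • f x) G (Ioi 0) := fun x hx => by
    simp only [hG, hfF (Ioi_subset_Ici_self hx)]
  refine ⟨hGi.integrableOn.congr_fun hcong.symm measurableSet_Ioi, ?_⟩
  rw [setIntegral_congr_fun measurableSet_Ioi hcong,
    setIntegral_eq_integral_of_forall_compl_eq_zero (s := Ioi (0 : ℝ))
      (fun x hx => hG0 x fun h => hx (mem_Ioi.2 (lt_of_lt_of_le hc h.1))),
    ← integral_add_left_eq_self G c]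
  have hsub := Measure.integral_comp_mul_left (fun x => G (c + x)) ε
  have h1 : ∫ x, G (c + x) = ε • ∫ x, G (c + ε * x) := by
    rw [hsub, abs_of_pos (inv_pos.2 hε), smul_smul, mul_inv_cancel₀ hε.ne', one_smul]
  rw [h1, ← integral_smul, intervalIntegral.integral_of_le zero_le_one]
  have h2 : (fun x => ε • G (c + ε * x)) = fun u => K u • F (c + ε * u) := by
    funext x
    simp only [hG, smul_smul]
    congr 1
    have : (c + ε * x - c) / ε = x := by field_simp; ring
    rw [this]
    field_simp
  rw [h2]
  refine (setIntegral_eq_integral_of_forall_compl_eq_zero fun x hx => ?_).symm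
  rw [hK, deriv_smoothTransition_eq_zero hx, zero_smul]

/-- The test function is a smoothed indicator of `[a, b]`. Its derivative is an approximate delta at
`a` minus one at `b`, so integration by parts bounds the smeared difference `J ε` by `C (b + ε -
a)`; then `ε → 0`. -/
theorem IsWeakDeriv.norm_sub_le [CompleteSpace V] {f g : ℝ → V} (hf : ContinuousOn f (Ici 0))
    (h : IsWeakDeriv f g) {C : ℝ} (hg : ∀ᵐ t ∂volPos, ‖g t‖ ≤ C)
    {a b : ℝ} (ha : 0 < a) (hab : a ≤ b) : ‖f a - f b‖ ≤ C * (b - a) := by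
  set F : ℝ → V := fun t => f (max t 0) with hF
  have hFc : Continuous F := hf.comp_continuous (by fun_prop) fun t => mem_Ici.2 (le_max_right _ _)
  have hfF : EqOn f F (Ici 0) := fun t ht => by simp [hF, max_eq_left (mem_Ici.1 ht)]
  set K := deriv Real.smoothTransition with hK
  have hKc : Continuous K := continuous_deriv_smoothTransition
  set J : ℝ → V := fun ε => ∫ u in (0 : ℝ)..1, K u • (F (a + ε * u) - F (b + ε * u)) with hJ
  have hJc : Continuous J := by
    refine intervalIntegral.continuous_parametric_intervalIntegral_of_continuous' ?_ 0 1
    fun_prop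
  have hJ0 : J 0 = f a - f b := by
    have hK1 : ∫ u in (0 : ℝ)..1, K u = 1 := by
      rw [hK, intervalIntegral.integral_deriv_eq_sub
        (fun x _ => (Real.smoothTransition.contDiff (n := 1)).differentiable one_ne_zero x)
        (hKc.intervalIntegrable _ _)]
      simp
    simp only [hJ, zero_mul, add_zero]
    rw [intervalIntegral.integral_smul_const, hK1, one_smul, hfF ha.le, hfF (ha.le.trans hab)]
  have hbound : ∀ ε > 0, ‖J ε‖ ≤ C * (b + ε - a) := by
    intro ε hε
    set ψ : ℝ → ℝ := fun x =>
      Real.smoothTransition ((x - a) / ε) - Real.smoothTransition ((x - b) / ε) with hψ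
    have hψ1 : ContDiff ℝ (⊤ : ℕ∞) ψ := by
      refine (Real.smoothTransition.contDiff.comp ?_).sub (Real.smoothTransition.contDiff.comp ?_)
      · exact (contDiff_id.sub contDiff_const).div_const _
      · exact (contDiff_id.sub contDiff_const).div_const _
    have hψ0 : ∀ x, x ∉ Icc a (b + ε) → ψ x = 0 := by
      intro x hx
      rcases lt_or_ge x a with hxa | hxa
      · simp only [hψ]
        rw [Real.smoothTransition.zero_of_nonpos, Real.smoothTransition.zero_of_nonpos, sub_zero]
        · exact div_nonpos_of_nonpos_of_nonneg (by linarith) hε.le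
        · exact div_nonpos_of_nonpos_of_nonneg (by linarith) hε.le
      · have hxb : b + ε < x := by
          by_contra! h'
          exact hx ⟨hxa, h'⟩
        simp only [hψ]
        rw [Real.smoothTransition.one_of_one_le, Real.smoothTransition.one_of_one_le, sub_self]
        · rw [le_div_iff₀ hε]; linarith
        · rw [le_div_iff₀ hε]; linarith
    have hψcs : HasCompactSupport ψ := HasCompactSupport.intro isCompact_Icc hψ0
    have hψts : tsupport ψ ⊆ Ioi 0 := by
      refine (closure_minimal (fun x hx => ?_) isClosed_Icc).trans
        (fun x (hx : x ∈ Icc a (b + ε)) => lt_of_lt_of_le ha hx.1)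
      by_contra hx'
      exact hx (hψ0 x hx')
    have hd : ∀ x, deriv ψ x = K ((x - a) / ε) * ε⁻¹ - K ((x - b) / ε) * ε⁻¹ := by
      intro x
      have hs : ∀ c, HasDerivAt (fun x => Real.smoothTransition ((x - c) / ε))
          (K ((x - c) / ε) * ε⁻¹) x := by
        intro c
        have h1 : HasDerivAt (fun x : ℝ => (x - c) / ε) ε⁻¹ x := by
          simpa using ((hasDerivAt_id x).sub_const c).div_const ε
        exact ((Real.smoothTransition.contDiff (n := 1)).differentiable
          one_ne_zero _).hasDerivAt.comp x h1
      exact ((hs a).sub (hs b)).deriv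
    have hb : 0 < b := ha.trans_le hab
    obtain ⟨hia, hea⟩ := setIntegral_scaled_bump hFc hfF ha hε
    obtain ⟨hib, heb⟩ := setIntegral_scaled_bump hFc hfF hb hε
    have hw := h ψ hψ1 hψcs hψts
    have hl : ∫ t in Ioi (0 : ℝ), deriv ψ t • f t = J ε := by
      simp only [hd, sub_smul]
      rw [integral_sub hia hib, hea, heb, ← intervalIntegral.integral_sub]
      · simp only [hJ, smul_sub, ← hK]
      · exact (hKc.smul (hFc.comp (by fun_prop))).intervalIntegrable _ _
      · exact (hKc.smul (hFc.comp (by fun_prop))).intervalIntegrable _ _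
    rw [← hl, hw, norm_neg]
    have hsub : Icc a (b + ε) ⊆ Ioi 0 := fun x hx => lt_of_lt_of_le ha hx.1
    rw [setIntegral_eq_of_subset_of_forall_sdiff_eq_zero measurableSet_Ioi hsub
      (fun x hx => by rw [hψ0 x hx.2, zero_smul])]
    refine (norm_setIntegral_le_of_norm_le_const_ae (C := C) (by simp) ?_).trans ?_
    · have hg' : ∀ᵐ t ∂(volume.restrict (Icc a (b + ε))), ‖g t‖ ≤ C :=
        ae_restrict_of_ae_restrict_of_subset (hsub.trans Ioi_subset_Ici_self) hg
      filter_upwards [hg'] with x hx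
      rw [norm_smul]
      have : ‖ψ x‖ ≤ 1 := by
        rw [Real.norm_eq_abs, abs_le]
        have := Real.smoothTransition.nonneg ((x - a) / ε)
        have := Real.smoothTransition.nonneg ((x - b) / ε)
        have := Real.smoothTransition.le_one ((x - a) / ε)
        have := Real.smoothTransition.le_one ((x - b) / ε)
        constructor <;> simp only [hψ] <;> linarith
      calc ‖ψ x‖ * ‖g x‖ ≤ 1 * C := by gcongr
        _ = C := one_mul _
    · rw [measureReal_def, Real.volume_Icc, ENNReal.toReal_ofReal (by linarith)]
  rw [← hJ0]
  have ht1 : Tendsto (fun ε => ‖J ε‖) (𝓝[>] 0) (𝓝 ‖J 0‖) :=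
    (hJc.norm.tendsto 0).mono_left nhdsWithin_le_nhds
  have ht2 : Tendsto (fun ε => C * (b + ε - a)) (𝓝[>] 0) (𝓝 (C * (b - a))) := by
    have : Continuous fun ε : ℝ => C * (b + ε - a) := by fun_prop
    simpa using (this.tendsto 0).mono_left nhdsWithin_le_nhds
  exact le_of_tendsto_of_tendsto ht1 ht2 (eventually_mem_nhdsWithin.mono fun ε hε => hbound ε hε)

theorem MemW1Inf.exists_lipschitzOnWith [CompleteSpace V] {f : ℝ → V} (hf : MemW1Inf f) :
    ∃ K : ℝ≥0, LipschitzOnWith K f (Ici 0) := by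
  obtain ⟨g, hg, hw⟩ := hf.exists_weakDeriv
  obtain ⟨C, hC, hgC⟩ := ae_norm_le_of_memLp_top hg
  refine ⟨C.toNNReal, ?_⟩
  rw [← closure_Ioi (0 : ℝ)]
  refine LipschitzOnWith.closure (by rw [closure_Ioi]; exact hf.continuousOn) ?_
  have key : ∀ a ∈ Ioi (0 : ℝ), ∀ b ∈ Ioi (0 : ℝ), a ≤ b → dist (f a) (f b) ≤ C * dist a b := by
    intro a ha b _ hab
    rw [dist_eq_norm, dist_comm, Real.dist_eq, abs_of_nonneg (by linarith : 0 ≤ b - a)]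
    exact hw.norm_sub_le hf.continuousOn hgC ha hab
  refine LipschitzOnWith.of_dist_le_mul fun a ha b hb => ?_
  rw [Real.coe_toNNReal C hC]
  rcases le_total a b with hab | hab
  · exact key a ha b hb hab
  · rw [dist_comm (f a), dist_comm a]
    exact key b hb a ha hab

theorem MemW1Inf.exists_norm_le {f : ℝ → V} (hf : MemW1Inf f) :
    ∃ C : ℝ, ∀ t, 0 ≤ t → ‖f t‖ ≤ C := by
  obtain ⟨C, _, h⟩ := ae_norm_le_of_memLp_top hf.memLp
  exact ⟨C, le_on_of_ae_le (s := Ici 0) (by simp) hf.continuousOn.norm continuousOn_const h⟩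

end WeakDeriv

/-! ### Local existence for functional differential equations by delay approximation -/

theorem isCompact_lipschitz_bounded {X V : Type*} [PseudoMetricSpace X] [CompactSpace X]
    [NormedAddCommGroup V] [ProperSpace V] (K : ℝ≥0) (δ : ℝ) :
    IsCompact {g : BoundedContinuousFunction X V |
      LipschitzWith K g ∧ ∀ x, g x ∈ Metric.closedBall (0 : V) δ} := by
  refine BoundedContinuousFunction.arzela_ascoli₂ (Metric.closedBall (0 : V) δ)
    (isCompact_closedBall _ _) _ ?_ (fun g x hg => hg.2 x) ?_
  · have h1 : IsClosed {g : BoundedContinuousFunction X V | LipschitzWith K g} := by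
      have := (isClosed_setOfPred_lipschitzWith (α := X) (β := V) K).preimage
        (BoundedContinuousFunction.continuous_coe (α := X) (β := V))
      simpa only [preimage_ofPred_eq] using this
    have h2 : IsClosed {g : BoundedContinuousFunction X V |
        ∀ x, g x ∈ Metric.closedBall (0 : V) δ} := by
      simp only [ofPred_forall]
      exact isClosed_iInter fun x => Metric.isClosed_closedBall.preimage
        (BoundedContinuousFunction.lipschitz_eval_const x).continuous
    exact h1.inter h2
  · exact (LipschitzWith.uniformEquicontinuous _ K fun g => g.2.1).equicontinuous

section Tonelli

variable {m q : ℕ}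

/-- Continuous curves on `[-σ, ∞)` with history `yh` on `[-σ, t₀]` which stay in the closed ball of
radius `δ` about `yh t₀` afterwards. -/
structure IsCurve (σ t₀ δ : ℝ) (yh Y : ℝ → E m) : Prop where
  continuousOn : ContinuousOn Y (Ici (-σ))
  eqOn : EqOn Y yh (Icc (-σ) t₀)
  mem_ball : ∀ t, t₀ ≤ t → ‖Y t - yh t₀‖ ≤ δ

/-- The standing assumptions for the delay approximation of the functional differential equation
`Y' = G(t, T(Y)(t), Y(t))` on `[t₀, t₁]` with history `yh`. -/
structure IsLocalProblem (σ t₀ t₁ δ M c : ℝ) (yh : ℝ → E m) (T : (ℝ → E m) → ℝ → E q)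
    (G : ℝ → E q → E m → E m) : Prop where
  memory_nonneg : 0 ≤ σ
  initial_nonneg : 0 ≤ t₀
  lt : t₀ < t₁
  bound_nonneg : 0 ≤ M
  history : ContinuousOn yh (Icc (-σ) t₀)
  small : M * (t₁ - t₀) ≤ δ
  causal : ∀ Y₁ Y₂, IsCurve σ t₀ δ yh Y₁ → IsCurve σ t₀ δ yh Y₂ → ∀ s, 0 ≤ s →
    EqOn Y₁ Y₂ (Icc (-σ) s) → T Y₁ =ᵐ[volume.restrict (Icc 0 s)] T Y₂
  lip : ∀ Y₁ Y₂, IsCurve σ t₀ δ yh Y₁ → IsCurve σ t₀ δ yh Y₂ → ∀ r, 0 ≤ r →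
    (∀ s, t₀ ≤ s → ‖Y₁ s - Y₂ s‖ ≤ r) →
    ∀ᵐ s ∂volume.restrict (Icc t₀ t₁), ‖T Y₁ s - T Y₂ s‖ ≤ c * r
  meas : ∀ Y, IsCurve σ t₀ δ yh Y →
    AEStronglyMeasurable (fun s => G s (T Y s) (Y s)) (volume.restrict (Icc t₀ t₁))
  bound : ∀ Y, IsCurve σ t₀ δ yh Y →
    ∀ᵐ s ∂volume.restrict (Icc t₀ t₁), ‖G s (T Y s) (Y s)‖ ≤ M
  cont : ∀ᵐ s ∂volume.restrict (Icc t₀ t₁),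
    ContinuousOn (fun p : E q × E m => G s p.1 p.2) (univ ×ˢ Metric.closedBall (yh t₀) δ)

/-- The integral of `G(s, T(Y)(s), Y(s))` over `[t₀, t] ∩ [t₀, t₁]`. -/
noncomputable def primitive (t₀ t₁ : ℝ) (T : (ℝ → E m) → ℝ → E q)
    (G : ℝ → E q → E m → E m) (Y : ℝ → E m) (t : ℝ) : E m :=
  ∫ s in t₀..max t₀ (min t t₁), G s (T Y s) (Y s)

/-- One step of the delayed Picard iteration. -/
noncomputable def delayStep (t₀ t₁ : ℝ) (yh : ℝ → E m) (T : (ℝ → E m) → ℝ → E q)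
    (G : ℝ → E q → E m → E m) (h : ℝ) (Y : ℝ → E m) (t : ℝ) : E m :=
  yh (min t t₀) + primitive t₀ t₁ T G Y (t - h)

theorem primitive_of_le {t₀ t₁ : ℝ} {T : (ℝ → E m) → ℝ → E q} {G : ℝ → E q → E m → E m}
    {Y : ℝ → E m} {t : ℝ} (ht : t ≤ t₀) : primitive t₀ t₁ T G Y t = 0 := by
  rw [primitive, max_eq_left ((min_le_left _ _).trans ht), intervalIntegral.integral_same]

namespace IsLocalProblem

variable {σ t₀ t₁ δ M c : ℝ} {yh : ℝ → E m} {T : (ℝ → E m) → ℝ → E q}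
  {G : ℝ → E q → E m → E m} {Y Y₁ Y₂ : ℝ → E m}

theorem clamp_mem (H : IsLocalProblem σ t₀ t₁ δ M c yh T G) (t : ℝ) :
    max t₀ (min t t₁) ∈ Icc t₀ t₁ :=
  ⟨le_max_left _ _, max_le H.lt.le (min_le_right _ _)⟩

theorem intervalIntegrable (H : IsLocalProblem σ t₀ t₁ δ M c yh T G)
    (hY : IsCurve σ t₀ δ yh Y) {a b : ℝ} (ha : a ∈ Icc t₀ t₁) (hb : b ∈ Icc t₀ t₁) :
    IntervalIntegrable (fun s => G s (T Y s) (Y s)) volume a b := by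
  have h1 : IntegrableOn (fun s => G s (T Y s) (Y s)) (Icc t₀ t₁) :=
    Integrable.of_bound (H.meas Y hY) M (H.bound Y hY)
  rw [intervalIntegrable_iff]
  refine h1.mono_set (uIoc_subset_uIcc.trans ?_)
  exact (convex_Icc t₀ t₁).ordConnected.uIcc_subset ha hb

theorem norm_integral_le (H : IsLocalProblem σ t₀ t₁ δ M c yh T G)
    (hY : IsCurve σ t₀ δ yh Y) {a b : ℝ} (ha : a ∈ Icc t₀ t₁) (hb : b ∈ Icc t₀ t₁) :
    ‖∫ s in a..b, G s (T Y s) (Y s)‖ ≤ M * |b - a| := by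
  refine intervalIntegral.norm_integral_le_of_norm_le_const_ae ?_
  filter_upwards [(ae_restrict_iff' measurableSet_Icc).1 (H.bound Y hY)] with s hs hs'
  exact hs ((convex_Icc t₀ t₁).ordConnected.uIcc_subset ha hb (uIoc_subset_uIcc hs'))

theorem lipschitzWith_primitive (H : IsLocalProblem σ t₀ t₁ δ M c yh T G)
    (hY : IsCurve σ t₀ δ yh Y) : LipschitzWith M.toNNReal (primitive t₀ t₁ T G Y) := by
  refine LipschitzWith.of_dist_le_mul fun t s => ?_
  rw [Real.coe_toNNReal _ H.bound_nonneg, dist_eq_norm, primitive, primitive,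
    intervalIntegral.integral_interval_sub_left
      (H.intervalIntegrable hY (left_mem_Icc.2 H.lt.le) (H.clamp_mem t))
      (H.intervalIntegrable hY (left_mem_Icc.2 H.lt.le) (H.clamp_mem s))]
  refine (H.norm_integral_le hY (H.clamp_mem s) (H.clamp_mem t)).trans ?_
  refine mul_le_mul_of_nonneg_left ?_ H.bound_nonneg
  rw [Real.dist_eq]
  refine (abs_max_sub_max_le_max _ _ _ _).trans ?_
  rw [sub_self, abs_zero, max_eq_right (abs_nonneg _)]
  refine (abs_min_sub_min_le_max _ _ _ _).trans ?_
  rw [sub_self, abs_zero, max_eq_left (abs_nonneg _)]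

theorem norm_primitive_le (H : IsLocalProblem σ t₀ t₁ δ M c yh T G)
    (hY : IsCurve σ t₀ δ yh Y) (t : ℝ) : ‖primitive t₀ t₁ T G Y t‖ ≤ δ := by
  refine (H.norm_integral_le hY (left_mem_Icc.2 H.lt.le) (H.clamp_mem t)).trans
    (le_trans ?_ H.small)
  refine mul_le_mul_of_nonneg_left ?_ H.bound_nonneg
  have := H.clamp_mem t
  rw [abs_of_nonneg (by linarith [this.1])]
  linarith [this.2]

theorem continuousOn_history (H : IsLocalProblem σ t₀ t₁ δ M c yh T G) :
    ContinuousOn (fun t => yh (min t t₀)) (Ici (-σ)) := by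
  refine H.history.comp (by fun_prop) fun t ht => ⟨le_min ht ?_, min_le_right _ _⟩
  linarith [H.memory_nonneg, H.initial_nonneg]

theorem isCurve_add (H : IsLocalProblem σ t₀ t₁ δ M c yh T G) {I : ℝ → E m} (hI : Continuous I)
    (hI0 : ∀ t, t ≤ t₀ → I t = 0) (hIδ : ∀ t, ‖I t‖ ≤ δ) :
    IsCurve σ t₀ δ yh (fun t => yh (min t t₀) + I t) where
  continuousOn := H.continuousOn_history.add hI.continuousOn
  eqOn t ht := by simp only [min_eq_left ht.2, hI0 t ht.2, add_zero]
  mem_ball t ht := by simpa only [min_eq_right ht, add_sub_cancel_left] using hIδ t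

theorem isCurve_delayStep (H : IsLocalProblem σ t₀ t₁ δ M c yh T G)
    (hY : IsCurve σ t₀ δ yh Y) {h : ℝ} (hh : 0 ≤ h) :
    IsCurve σ t₀ δ yh (delayStep t₀ t₁ yh T G h Y) :=
  H.isCurve_add ((H.lipschitzWith_primitive hY).continuous.comp (continuous_sub_right h))
    (fun _ ht => primitive_of_le (by linarith)) (fun _ => H.norm_primitive_le hY _)

/-- Causality of `T`: the integral up to `t` sees the curve only up to `min t t₁`. -/
theorem primitive_congr (H : IsLocalProblem σ t₀ t₁ δ M c yh T G)
    (h₁ : IsCurve σ t₀ δ yh Y₁) (h₂ : IsCurve σ t₀ δ yh Y₂) {τ t : ℝ} (h : EqOn Y₁ Y₂ (Iic τ))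
    (ht : min t t₁ ≤ τ) : primitive t₀ t₁ T G Y₁ t = primitive t₀ t₁ T G Y₂ t := by
  rcases le_or_gt t t₀ with htt | htt
  · rw [primitive_of_le htt, primitive_of_le htt]
  have hu : max t₀ (min t t₁) = min t t₁ := max_eq_right (le_min htt.le H.lt.le)
  have hpos : t₀ ≤ min t t₁ := le_min htt.le H.lt.le
  rw [primitive, primitive, hu]
  refine intervalIntegral.integral_congr_ae ?_
  have hc := H.causal Y₁ Y₂ h₁ h₂ (min t t₁) (H.initial_nonneg.trans hpos)
    (h.mono fun s hs => hs.2.trans ht)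
  filter_upwards [(ae_restrict_iff' measurableSet_Icc).1 hc] with s hs hs'
  rw [uIoc_of_le hpos] at hs'
  rw [hs ⟨H.initial_nonneg.trans hs'.1.le, hs'.2⟩, h (mem_Iic.2 (hs'.2.trans ht))]

/-- Each step of the iteration determines the curve on a further interval of length `h`. Once `n h >
t₁ - t₀` the iterates agree up to `t₁`, and primitives are constant beyond `t₁`, so the iteration
reaches an exact fixed point. -/
theorem exists_delay_solution (H : IsLocalProblem σ t₀ t₁ δ M c yh T G) {h : ℝ} (hh : 0 < h) :
    ∃ Y, IsCurve σ t₀ δ yh Y ∧ ∀ t, Y t = yh (min t t₀) + primitive t₀ t₁ T G Y (t - h) := by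
  set S := delayStep t₀ t₁ yh T G h with hS
  have hδ : 0 ≤ δ := (mul_nonneg H.bound_nonneg (by linarith [H.lt])).trans H.small
  -- The summand `0` puts the starting curve into the shape required by `isCurve_add`.
  set Y₀ : ℝ → E m := fun t => yh (min t t₀) + 0 with hY₀
  have hcurve : ∀ j, IsCurve σ t₀ δ yh (S^[j] Y₀) := by
    intro j
    induction j with
    | zero => exact H.isCurve_add continuous_const (fun _ _ => rfl) (fun _ => by simpa using hδ)
    | succ j ih =>
      rw [Function.iterate_succ_apply']
      exact H.isCurve_delayStep ih hh.le
  have hsucc : ∀ (j : ℕ) (t : ℝ),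
      S^[j + 1] Y₀ t = yh (min t t₀) + primitive t₀ t₁ T G (S^[j] Y₀) (t - h) := fun j t => by
    rw [Function.iterate_succ_apply']; rfl
  have hstab : ∀ j : ℕ, EqOn (S^[j + 1] Y₀) (S^[j] Y₀) (Iic (t₀ + j * h)) := by
    intro j
    induction j with
    | zero =>
      intro t ht
      have ht' : t ≤ t₀ := by simpa using ht
      simp only [Function.iterate_succ_apply', Function.iterate_zero, id, hS, delayStep, hY₀]
      rw [primitive_of_le (by linarith)]
    | succ j ih =>
      intro t ht
      have ht' : t ≤ t₀ + (j + 1 : ℝ) * h := by simpa using ht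
      rw [hsucc (j + 1), hsucc j, H.primitive_congr (hcurve (j + 1)) (hcurve j) ih]
      exact (min_le_left _ _).trans (by linarith)
  obtain ⟨n, hn⟩ := exists_nat_gt ((t₁ - t₀) / h)
  rw [div_lt_iff₀ hh] at hn
  refine ⟨S^[n + 1] Y₀, hcurve _, fun t => ?_⟩
  rw [H.primitive_congr (hcurve (n + 1)) (hcurve n) (hstab n)
    ((min_le_right _ _).trans (by linarith)), hsucc n]

/-- The primitives of the solutions with delay `1 / (n + 1)` are uniformly bounded and
`M`-Lipschitz, so a subsequence converges uniformly. The Lipschitz property of `T` carries this over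
to `T(Z) → T(Y)` almost everywhere, and dominated convergence passes to the limit in the integral
equation. -/
theorem exists_solution (H : IsLocalProblem σ t₀ t₁ δ M c yh T G) :
    ∃ Y, IsCurve σ t₀ δ yh Y ∧ ∀ t, Y t = yh (min t t₀) + primitive t₀ t₁ T G Y t := by
  set h : ℕ → ℝ := fun n => 1 / ((n : ℝ) + 1) with hh
  have hh0 : ∀ n, 0 < h n := fun n => Nat.one_div_pos_of_nat
  choose Z hZ hZeq using fun n => H.exists_delay_solution (hh0 n)
  set P : ℕ → ℝ → E m := fun n => primitive t₀ t₁ T G (Z n) with hP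
  have hPl : ∀ n, LipschitzWith M.toNNReal (P n) := fun n => H.lipschitzWith_primitive (hZ n)
  let f : ℕ → BoundedContinuousFunction (Icc t₀ t₁) (E m) := fun n =>
    BoundedContinuousFunction.mkOfCompact ⟨fun x => P n x, (hPl n).continuous.comp
      continuous_subtype_val⟩
  let A : Set (BoundedContinuousFunction (Icc t₀ t₁) (E m)) :=
    {g | LipschitzWith M.toNNReal g ∧ ∀ x, g x ∈ Metric.closedBall (0 : E m) δ}
  have hA : IsCompact A := isCompact_lipschitz_bounded _ _
  have hfA : ∀ n, f n ∈ A := fun n =>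
    ⟨fun x y => hPl n x y, fun x => by simpa [f] using H.norm_primitive_le (hZ n) x⟩
  obtain ⟨a, -, ψ, hψ, hlim⟩ := hA.tendsto_subseq hfA
  -- Primitives are constant outside `[t₀, t₁]`, so extending the limit by projection keeps the
  -- convergence uniform on all of `ℝ`.
  set I : ℝ → E m := fun t => a (projIcc t₀ t₁ H.lt.le t) with hI
  have hIc : Continuous I := a.continuous.comp continuous_projIcc
  have hdist : ∀ n t, ‖P n t - I t‖ ≤ dist (f n) a := by
    intro n t
    rw [← dist_eq_norm]
    have h1 : P n t = f n (projIcc t₀ t₁ H.lt.le t) := by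
      simp only [f, hP, BoundedContinuousFunction.mkOfCompact_apply, ContinuousMap.coe_mk,
        coe_projIcc, primitive]
      congr 1
      rw [min_comm t t₁, min_eq_left (max_le H.lt.le (min_le_left _ _)), max_eq_right
        (le_max_left _ _)]
    rw [h1]
    exact BoundedContinuousFunction.dist_coe_le_dist _
  -- The first term is the cost of removing the delay from an `M`-Lipschitz primitive, the second
  -- the uniform distance to the limit.
  set e : ℕ → ℝ := fun k => M * h (ψ k) + dist (f (ψ k)) a with he
  have he0 : Tendsto e atTop (𝓝 0) := by
    have h1 : Tendsto (fun k => dist (f (ψ k)) a) atTop (𝓝 0) := tendsto_iff_dist_tendsto_zero.1 hlim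
    have h2 : Tendsto (fun k => h (ψ k)) atTop (𝓝 0) :=
      tendsto_one_div_add_atTop_nhds_zero_nat.comp hψ.tendsto_atTop
    simpa using (h2.const_mul M).add h1
  have hPI : ∀ t, Tendsto (fun k => P (ψ k) t) atTop (𝓝 (I t)) := fun t =>
    tendsto_iff_norm_sub_tendsto_zero.2 (squeeze_zero (fun _ => norm_nonneg _)
      (fun k => hdist (ψ k) t) (tendsto_iff_dist_tendsto_zero.1 hlim))
  set Y : ℝ → E m := fun t => yh (min t t₀) + I t with hY
  have hYc : IsCurve σ t₀ δ yh Y := by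
    refine H.isCurve_add hIc (fun t ht => ?_) (fun t => ?_)
    · refine tendsto_nhds_unique (hPI t) ?_
      simp only [hP, primitive_of_le ht]
      exact tendsto_const_nhds
    · exact le_of_tendsto' (hPI t).norm fun k => H.norm_primitive_le (hZ _) t
  have hZY : ∀ k t, ‖Z (ψ k) t - Y t‖ ≤ e k := by
    intro k t
    rw [hZeq, hY]
    simp only [add_sub_add_left_eq_sub]
    rw [← sub_add_sub_cancel _ (P (ψ k) t)]
    refine (norm_add_le _ _).trans (add_le_add ?_ (hdist _ _))
    have := (hPl (ψ k)).dist_le_mul (t - h (ψ k)) t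
    rw [Real.coe_toNNReal _ H.bound_nonneg, dist_eq_norm, Real.dist_eq] at this
    simpa [abs_of_pos (hh0 _)] using this
  have hZYt : ∀ t, Tendsto (fun k => Z (ψ k) t) atTop (𝓝 (Y t)) := fun t =>
    tendsto_iff_norm_sub_tendsto_zero.2 (squeeze_zero (fun _ => norm_nonneg _)
      (fun k => hZY k t) he0)
  refine ⟨Y, hYc, fun t => ?_⟩
  simp only [hY, add_right_inj]
  refine tendsto_nhds_unique (hPI t) ?_
  have hlip : ∀ᵐ s ∂volume.restrict (Icc t₀ t₁), ∀ k, ‖T (Z (ψ k)) s - T Y s‖ ≤ c * e k :=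
    ae_all_iff.2 fun k => H.lip _ _ (hZ _) hYc _ ((norm_nonneg _).trans (hZY k t₀))
      fun s _ => hZY k s
  have hsub : Ι t₀ (max t₀ (min t t₁)) ⊆ Icc t₀ t₁ :=
    uIoc_subset_uIcc.trans ((convex_Icc t₀ t₁).ordConnected.uIcc_subset
      (left_mem_Icc.2 H.lt.le) (H.clamp_mem t))
  refine intervalIntegral.tendsto_integral_filter_of_dominated_convergence (fun _ => M)
    (Eventually.of_forall fun k => (H.meas _ (hZ _)).mono_measure
      (Measure.restrict_mono hsub le_rfl))
    (Eventually.of_forall fun k => ?_) intervalIntegrable_const ?_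
  · filter_upwards [(ae_restrict_iff' measurableSet_Icc).1 (H.bound _ (hZ (ψ k)))] with s hs hs'
    exact hs (hsub hs')
  · filter_upwards [(ae_restrict_iff' measurableSet_Icc).1 H.cont,
      (ae_restrict_iff' measurableSet_Icc).1 hlip] with s hs1 hs2 hs'
    have hsI := hsub hs'
    have hT : Tendsto (fun k => T (Z (ψ k)) s) atTop (𝓝 (T Y s)) :=
      tendsto_iff_norm_sub_tendsto_zero.2 (squeeze_zero (fun _ => norm_nonneg _)
        (fun k => hs2 hsI k) (by simpa using he0.const_mul c))
    have hmem : ∀ W, IsCurve σ t₀ δ yh W →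
        (T W s, W s) ∈ (univ : Set (E q)) ×ˢ Metric.closedBall (yh t₀) δ := fun W hW =>
      ⟨mem_univ _, mem_closedBall_iff_norm.2 (hW.mem_ball s hsI.1)⟩
    have hcw := hs1 hsI _ (hmem Y hYc)
    exact hcw.tendsto.comp (tendsto_nhdsWithin_iff.2
      ⟨hT.prodMk_nhds (hZYt s), Eventually.of_forall fun k => hmem _ (hZ _)⟩)

theorem ae_hasDerivAt (H : IsLocalProblem σ t₀ t₁ δ M c yh T G) (hY : IsCurve σ t₀ δ yh Y)
    (hYeq : ∀ t, Y t = yh (min t t₀) + primitive t₀ t₁ T G Y t) :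
    ∀ᵐ t ∂volume.restrict (Icc t₀ t₁), HasDerivAt Y (G t (T Y t) (Y t)) t := by
  have h1 := (H.intervalIntegrable hY (left_mem_Icc.2 H.lt.le)
    (right_mem_Icc.2 H.lt.le)).ae_hasDerivAt_integral
  rw [← restrict_Ioo_eq_restrict_Icc, ae_restrict_iff' measurableSet_Ioo]
  filter_upwards [h1] with t ht htI
  have h2 := ht (by rw [uIcc_of_le H.lt.le]; exact Ioo_subset_Icc_self htI) t₀ (by simp)
  refine (h2.const_add (yh t₀)).congr_of_eventuallyEq ?_
  filter_upwards [isOpen_Ioo.mem_nhds htI] with s hs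
  rw [hYeq s, primitive, min_eq_right hs.1.le, min_eq_left hs.2.le, max_eq_right hs.1.le]

end IsLocalProblem

end Tonelli

/-! ### Local solvability of the closed loop -/

/-- The assumptions on the data of the closed-loop initial value problem. -/
structure IsFunnelProblem {p q m : ℕ} (σ : ℝ) (d : ℝ → E p) (F : E p × E q × E m → E m)
    (T : (ℝ → E m) → ℝ → E q) (y₀ D : ℝ → E m) (β N α : ℝ → ℝ) (ρ : ℝ → E m) (φ : ℝ → ℝ) :
    Prop where
  sys : SystemClass σ d F T
  history : ContinuousOn y₀ (Icc (-σ) 0)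
  input_disturbance : MemLp D ⊤ volPos
  switch_continuousOn : ContinuousOn N (Ici 0)
  switch_surjOn : SurjOn N (Ici 0) univ
  gain_continuousOn : ContinuousOn α (Ico 0 1)
  gain_bijOn : BijOn α (Ico 0 1) (Ici 1)
  scale_continuousOn : ContinuousOn β (Icc 0 1)
  scale_one_pos : 0 < β 1
  reference : MemW1Inf ρ
  funnel : IsFunnelFunction φ
  initial : ‖y₀ 0 - ρ 0‖ < φ 0

theorem IsFunnelFunction.exists_pos_le {φ : ℝ → ℝ} (hφ : IsFunnelFunction φ) :
    ∃ ε > 0, ∀ t, 0 ≤ t → ε ≤ φ t := by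
  refine ⟨_, hφ.inf_pos, fun t ht => csInf_le ?_ (mem_image_of_mem φ ht)⟩
  by_contra h
  exact hφ.inf_pos.ne' (Real.sInf_of_not_bddBelow h)

theorem IsFunnelFunction.pos {φ : ℝ → ℝ} (hφ : IsFunnelFunction φ) {t : ℝ} (ht : 0 ≤ t) :
    0 < φ t := by
  obtain ⟨ε, hε, h⟩ := hφ.exists_pos_le
  exact hε.trans_le (h t ht)

theorem norm_normalizedError {m : ℕ} {ρ y : ℝ → E m} {φ : ℝ → ℝ} (hφ : IsFunnelFunction φ) {t : ℝ}
    (ht : 0 ≤ t) : ‖normalizedError ρ φ y t‖ = ‖y t - ρ t‖ / φ t := by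
  rw [normalizedError, norm_smul, norm_inv, Real.norm_of_nonneg (hφ.pos ht).le, div_eq_inv_mul]

/-- The control law as a function of time and current output value. -/
noncomputable def stateFeedback {m : ℕ} (β N α : ℝ → ℝ) (ρ : ℝ → E m) (φ : ℝ → ℝ) (t : ℝ)
    (x : E m) : E m :=
  feedback β N α ((φ t)⁻¹ • (x - ρ t))

namespace IsFunnelProblem

variable {p q m : ℕ} {σ : ℝ} {d : ℝ → E p} {F : E p × E q × E m → E m}
  {T : (ℝ → E m) → ℝ → E q} {y₀ D : ℝ → E m} {β N α : ℝ → ℝ} {ρ : ℝ → E m} {φ : ℝ → ℝ}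

theorem continuousOn_gain (H : IsFunnelProblem σ d F T y₀ D β N α ρ φ) :
    ContinuousOn (fun r => β r * N (α (r ^ 2))) (Ico 0 1) := by
  have h2 : MapsTo (fun r : ℝ => r ^ 2) (Ico 0 1) (Ico 0 1) := fun r hr =>
    ⟨sq_nonneg r, pow_lt_one₀ hr.1 hr.2 two_ne_zero⟩
  refine (H.scale_continuousOn.mono Ico_subset_Icc_self).mul (H.switch_continuousOn.comp
    (H.gain_continuousOn.comp (by fun_prop) h2) fun r hr => ?_)
  exact mem_Ici.2 (zero_le_one.trans (H.gain_bijOn.mapsTo (h2 hr)))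

theorem continuousOn_feedback (H : IsFunnelProblem σ d F T y₀ D β N α ρ φ) :
    ContinuousOn (feedback β N α : E m → E m) (Metric.ball 0 1) :=
  (H.continuousOn_gain.comp (t := Ico 0 1) continuous_norm.continuousOn fun w hw =>
    ⟨norm_nonneg w, mem_ball_zero_iff.1 hw⟩).smul continuousOn_id

theorem continuousOn_normalize (H : IsFunnelProblem σ d F T y₀ D β N α ρ φ) :
    ContinuousOn (fun x : ℝ × E m => (φ x.1)⁻¹ • (x.2 - ρ x.1)) (Ici 0 ×ˢ univ) := by
  have hfst : MapsTo (Prod.fst : ℝ × E m → ℝ) (Ici 0 ×ˢ univ) (Ici 0) := fun x hx => hx.1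
  have h1 : ContinuousOn (fun x : ℝ × E m => φ x.1) (Ici 0 ×ˢ univ) :=
    H.funnel.memW1Inf.continuousOn.comp continuousOn_fst hfst
  have h2 : ContinuousOn (fun x : ℝ × E m => ρ x.1) (Ici 0 ×ˢ univ) :=
    H.reference.continuousOn.comp continuousOn_fst hfst
  exact (h1.inv₀ fun x hx => (H.funnel.pos (hfst hx)).ne').smul (continuousOn_snd.sub h2)

theorem exists_ball_in_funnel (H : IsFunnelProblem σ d F T y₀ D β N α ρ φ) {t₀ : ℝ} {x₀ : E m}
    (ht₀ : 0 ≤ t₀) (hx₀ : ‖(φ t₀)⁻¹ • (x₀ - ρ t₀)‖ < 1) :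
    ∃ ε > 0, ∃ δ > 0, ∀ t ∈ Icc t₀ (t₀ + ε), ∀ x ∈ Metric.closedBall x₀ δ,
      ‖(φ t)⁻¹ • (x - ρ t)‖ < 1 := by
  have h1 := (H.continuousOn_normalize (t₀, x₀) ⟨ht₀, mem_univ _⟩).norm.eventually_lt_const hx₀
  rw [nhdsWithin_prod_eq, nhdsWithin_univ] at h1
  obtain ⟨pt, hpt, px, hpx, h⟩ := eventually_prod_iff.1 h1
  obtain ⟨δ, hδ, hδx⟩ := Metric.nhds_basis_closedBall.eventually_iff.1 hpx
  have h2 : ∀ᶠ t in 𝓝[≥] t₀, pt t := nhdsWithin_mono t₀ (Ici_subset_Ici.2 ht₀) hpt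
  obtain ⟨u, hu, hut⟩ := mem_nhdsGE_iff_exists_Icc_subset.1 h2
  refine ⟨u - t₀, sub_pos.2 hu, δ, hδ, fun t ht x hx => h (hut ?_) (hδx hx)⟩
  simpa using ht

/-- BIBO concerns globally bounded inputs. It applies because an `IsCurve` stays in the ball for all
times after `t₀`, not just up to `t₁`. -/
theorem exists_bound_operator {σ : ℝ} {T : (ℝ → E m) → ℝ → E q} (hT : IsAdmissibleOperator σ T)
    {t₀ δ : ℝ} {yh : ℝ → E m} (hyh : ContinuousOn yh (Icc (-σ) t₀)) :
    ∃ R : ℝ, ∀ Y, IsCurve σ t₀ δ yh Y → ∀ᵐ t ∂volPos, ‖T Y t‖ ≤ R := by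
  obtain ⟨C, hC⟩ := isCompact_Icc.exists_bound_of_continuousOn hyh
  obtain ⟨R, -, hR⟩ := hT.bibo (max (max C (‖yh t₀‖ + δ)) 1) (by positivity)
  refine ⟨R, fun Y hY => hR Y hY.continuousOn fun t ht => ?_⟩
  refine le_trans ?_ (le_max_left _ _)
  rcases le_total t t₀ with h | h
  · rw [hY.eqOn ⟨ht, h⟩]
    exact (hC t ⟨ht, h⟩).trans (le_max_left _ _)
  · refine le_trans ?_ (le_max_right _ _)
    have h1 := hY.mem_ball t h
    have h2 := norm_add_le (yh t₀) (Y t - yh t₀)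
    rw [add_sub_cancel] at h2
    linarith

theorem ae_norm_sub_le {σ : ℝ} {T : (ℝ → E m) → ℝ → E q}
    {t₀ Δ δT c : ℝ} {yh : ℝ → E m}
    (hlip : ∀ y₁ y₂ : ℝ → E m, ContinuousOn y₁ (Ici (-σ)) → ContinuousOn y₂ (Ici (-σ)) →
        EqOn y₁ yh (Icc (-σ) t₀) → EqOn y₂ yh (Icc (-σ) t₀) →
        (∀ s ∈ Icc t₀ (t₀ + Δ), ‖y₁ s - yh t₀‖ < δT) →
        (∀ s ∈ Icc t₀ (t₀ + Δ), ‖y₂ s - yh t₀‖ < δT) →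
        eLpNorm (fun s => T y₁ s - T y₂ s) ⊤ (volume.restrict (Icc t₀ (t₀ + Δ)))
          ≤ ENNReal.ofReal c * ⨆ s ∈ Icc t₀ (t₀ + Δ), ‖y₁ s - y₂ s‖ₑ) (hc : 0 ≤ c)
    {δ : ℝ} (hδ : δ < δT) {Y₁ Y₂ : ℝ → E m} (h₁ : IsCurve σ t₀ δ yh Y₁)
    (h₂ : IsCurve σ t₀ δ yh Y₂) {r : ℝ} (hr : 0 ≤ r) (h : ∀ s, t₀ ≤ s → ‖Y₁ s - Y₂ s‖ ≤ r) :
    ∀ᵐ s ∂volume.restrict (Icc t₀ (t₀ + Δ)), ‖T Y₁ s - T Y₂ s‖ ≤ c * r := by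
  have h3 := hlip Y₁ Y₂ h₁.continuousOn h₂.continuousOn h₁.eqOn h₂.eqOn
    (fun s hs => (h₁.mem_ball s hs.1).trans_lt hδ) (fun s hs => (h₂.mem_ball s hs.1).trans_lt hδ)
  have h4 : ⨆ s ∈ Icc t₀ (t₀ + Δ), ‖Y₁ s - Y₂ s‖ₑ ≤ ENNReal.ofReal r := by
    refine iSup₂_le fun s hs => ?_
    rw [← ofReal_norm]
    exact ENNReal.ofReal_le_ofReal (h s hs.1)
  have h5 := h3.trans (mul_le_mul_right h4 _)
  rw [← ENNReal.ofReal_mul hc, eLpNorm_exponent_top] at h5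
  filter_upwards [ae_le_eLpNormEssSup (f := fun s => T Y₁ s - T Y₂ s)
    (μ := volume.restrict (Icc t₀ (t₀ + Δ)))] with s hs
  have h6 := hs.trans h5
  rw [← ofReal_norm] at h6
  exact (ENNReal.ofReal_le_ofReal_iff (by positivity)).1 h6

theorem continuousOn_stateFeedback (H : IsFunnelProblem σ d F T y₀ D β N α ρ φ) {s : Set ℝ}
    {B : Set (E m)} (hs : s ⊆ Ici 0)
    (hball : ∀ t ∈ s, ∀ x ∈ B, ‖(φ t)⁻¹ • (x - ρ t)‖ < 1) :
    ContinuousOn (fun x : ℝ × E m => stateFeedback β N α ρ φ x.1 x.2) (s ×ˢ B) :=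
  H.continuousOn_feedback.comp (H.continuousOn_normalize.mono (prod_mono hs (subset_univ _)))
    fun x hx => mem_ball_zero_iff.2 (hball x.1 hx.1 x.2 hx.2)

theorem aestronglyMeasurable_field (H : IsFunnelProblem σ d F T y₀ D β N α ρ φ) {t₀ t₁ : ℝ}
    (ht₀ : 0 ≤ t₀) (ht : t₀ ≤ t₁) {Y : ℝ → E m} (hY : ContinuousOn Y (Ici (-σ)))
    {B : Set (E m)} (hYB : ∀ t ∈ Icc t₀ t₁, Y t ∈ B)
    (hball : ∀ t ∈ Icc t₀ t₁, ∀ x ∈ B, ‖(φ t)⁻¹ • (x - ρ t)‖ < 1) :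
    AEStronglyMeasurable (fun s => F (d s, T Y s, D s + stateFeedback β N α ρ φ s (Y s)))
      (volume.restrict (Icc t₀ t₁)) := by
  have hsub : Icc t₀ t₁ ⊆ Ici 0 := fun t ht => mem_Ici.2 (ht₀.trans ht.1)
  have hd : AEStronglyMeasurable d (volume.restrict (Icc t₀ t₁)) :=
    H.sys.disturbance.1.mono_measure (Measure.restrict_mono hsub le_rfl)
  have hD : AEStronglyMeasurable D (volume.restrict (Icc t₀ t₁)) :=
    H.input_disturbance.1.mono_measure (Measure.restrict_mono hsub le_rfl)
  have hTY : AEStronglyMeasurable (T Y) (volume.restrict (Icc t₀ t₁)) :=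
    (H.sys.operator.memLp_loc Y hY t₁ (ht₀.trans ht)).1.mono_measure
      (Measure.restrict_mono (Icc_subset_Icc_left ht₀) le_rfl)
  have hYc : ContinuousOn Y (Icc t₀ t₁) := hY.mono fun t ht => by
    have := H.sys.memory_nonneg
    exact mem_Ici.2 (by linarith [ht.1])
  have hUm : AEStronglyMeasurable (fun s => stateFeedback β N α ρ φ s (Y s))
      (volume.restrict (Icc t₀ t₁)) :=
    ((H.continuousOn_stateFeedback hsub hball).comp (continuousOn_id.prodMk hYc)
      fun t ht => ⟨ht, hYB t ht⟩).aestronglyMeasurable measurableSet_Icc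
  exact H.sys.continuous.comp_aestronglyMeasurable (hd.prodMk (hTY.prodMk (hD.add hUm)))

/-- `F` is bounded on a product of closed balls. The exceptional null set comes from `d` and `D`
alone, so it serves all `z` and `u` simultaneously. -/
theorem exists_field_bound (H : IsFunnelProblem σ d F T y₀ D β N α ρ φ) (R CU : ℝ) :
    ∃ M : ℝ, 0 ≤ M ∧ ∀ᵐ t ∂volPos, ∀ z u, ‖z‖ ≤ R → ‖u‖ ≤ CU → ‖F (d t, z, D t + u)‖ ≤ M := by
  obtain ⟨Cd, -, hCd⟩ := ae_norm_le_of_memLp_top H.sys.disturbance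
  obtain ⟨CD, -, hCD⟩ := ae_norm_le_of_memLp_top H.input_disturbance
  have hK : IsCompact (Metric.closedBall (0 : E p) Cd ×ˢ Metric.closedBall (0 : E q) R ×ˢ
      Metric.closedBall (0 : E m) (CD + CU)) :=
    (isCompact_closedBall _ _).prod ((isCompact_closedBall _ _).prod (isCompact_closedBall _ _))
  obtain ⟨M, hM⟩ := hK.exists_bound_of_continuousOn (f := F) H.sys.continuous.continuousOn
  refine ⟨max M 0, le_max_right _ _, ?_⟩
  filter_upwards [hCd, hCD] with t h1 h2 z u hz hu
  have h3 : D t + u ∈ Metric.closedBall (0 : E m) (CD + CU) :=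
    mem_closedBall_zero_iff.2 ((norm_add_le _ _).trans (add_le_add h2 hu))
  have h4 : (d t, z, D t + u) ∈ Metric.closedBall (0 : E p) Cd ×ˢ Metric.closedBall (0 : E q) R ×ˢ
      Metric.closedBall (0 : E m) (CD + CU) :=
    mk_mem_prod (mem_closedBall_zero_iff.2 h1) (mk_mem_prod (mem_closedBall_zero_iff.2 hz) h3)
  exact (hM _ h4).trans (le_max_left _ _)

theorem exists_isLocalProblem (H : IsFunnelProblem σ d F T y₀ D β N α ρ φ) {t₀ : ℝ}
    (ht₀ : 0 ≤ t₀) {yh : ℝ → E m} (hyh : ContinuousOn yh (Icc (-σ) t₀))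
    (hin : ‖normalizedError ρ φ yh t₀‖ < 1) :
    ∃ t₁ δ M c, IsLocalProblem σ t₀ t₁ δ M c yh T
        (fun t z x => F (d t, z, D t + stateFeedback β N α ρ φ t x)) ∧
      ∀ t ∈ Icc t₀ t₁, ∀ x ∈ Metric.closedBall (yh t₀) δ, ‖(φ t)⁻¹ • (x - ρ t)‖ < 1 := by
  obtain ⟨ε, hε, δ₀, hδ₀, hball₀⟩ := H.exists_ball_in_funnel ht₀ hin
  obtain ⟨Δ, δT, c, hΔ, hδT, hc, hlip⟩ := H.sys.operator.locally_lipschitz t₀ ht₀ yh hyh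
  obtain ⟨δ, hδ0, hδδ₀, hδT'⟩ : ∃ δ, 0 < δ ∧ δ ≤ δ₀ ∧ δ < δT :=
    ⟨min δ₀ (δT / 2), lt_min hδ₀ (half_pos hδT), min_le_left _ _,
      (min_le_right _ _).trans_lt (half_lt_self hδT)⟩
  have hball : ∀ t ∈ Icc t₀ (t₀ + ε), ∀ x ∈ Metric.closedBall (yh t₀) δ,
      ‖(φ t)⁻¹ • (x - ρ t)‖ < 1 := fun t ht x hx =>
    hball₀ t ht x (Metric.closedBall_subset_closedBall hδδ₀ hx)
  have hsubpos : Icc t₀ (t₀ + ε) ⊆ Ici 0 := fun t ht => mem_Ici.2 (ht₀.trans ht.1)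
  have hUc := H.continuousOn_stateFeedback hsubpos hball
  obtain ⟨CU, hCU⟩ := (isCompact_Icc.prod
    (isCompact_closedBall (yh t₀) δ)).exists_bound_of_continuousOn hUc
  obtain ⟨R, hR⟩ := exists_bound_operator (δ := δ) H.sys.operator hyh
  obtain ⟨M, hM0, hM⟩ := H.exists_field_bound R CU
  -- The radius `δ` is fixed first, because `M` depends on it; the end time then shrinks so that
  -- speed `M` cannot leave the ball. Dividing by `M + 1` covers `M = 0`.
  obtain ⟨t₁, ht₁, ht₁ε, ht₁Δ, hsmall⟩ : ∃ t₁, t₀ < t₁ ∧ t₁ ≤ t₀ + ε ∧ t₁ ≤ t₀ + Δ ∧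
      M * (t₁ - t₀) ≤ δ := by
    have hpos : 0 < δ / (M + 1) := by positivity
    refine ⟨t₀ + min (min ε Δ) (δ / (M + 1)), ?_, ?_, ?_, ?_⟩
    · linarith [lt_min (lt_min hε hΔ) hpos]
    · linarith [(min_le_left (min ε Δ) (δ / (M + 1))).trans (min_le_left _ _)]
    · linarith [(min_le_left (min ε Δ) (δ / (M + 1))).trans (min_le_right _ _)]
    · rw [add_sub_cancel_left]
      calc M * min (min ε Δ) (δ / (M + 1)) ≤ M * (δ / (M + 1)) := by
            gcongr; exact min_le_right _ _
        _ ≤ δ := by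
          rw [mul_div_assoc', div_le_iff₀ (by positivity)]
          nlinarith
  have hsub : Icc t₀ t₁ ⊆ Icc t₀ (t₀ + ε) := Icc_subset_Icc_right ht₁ε
  have hcurve : ∀ Y, IsCurve σ t₀ δ yh Y → ∀ t ∈ Icc t₀ t₁,
      Y t ∈ Metric.closedBall (yh t₀) δ :=
    fun Y hY t ht => mem_closedBall_iff_norm.2 (hY.mem_ball t ht.1)
  refine ⟨t₁, δ, M, c, ⟨H.sys.memory_nonneg, ht₀, ht₁, hM0, hyh, hsmall,
    fun Y₁ Y₂ h₁ h₂ s hs h =>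
        H.sys.operator.causal Y₁ Y₂ h₁.continuousOn h₂.continuousOn s hs h,
    fun Y₁ Y₂ h₁ h₂ r hr h => ae_restrict_of_ae_restrict_of_subset
        (Icc_subset_Icc_right ht₁Δ) (ae_norm_sub_le hlip hc.le hδT' h₁ h₂ hr h),
    fun Y hY => H.aestronglyMeasurable_field ht₀ ht₁.le hY.continuousOn (hcurve Y hY)
      fun t ht => hball t (hsub ht),
    fun Y hY => ?_, ?_⟩, fun t ht => hball t (hsub ht)⟩
  · filter_upwards [ae_restrict_of_ae_restrict_of_subset (hsub.trans hsubpos) hM,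
      ae_restrict_of_ae_restrict_of_subset (hsub.trans hsubpos) (hR Y hY),
      ae_restrict_mem measurableSet_Icc] with s h1 h2 h3
    exact h1 _ _ h2 (hCU (s, Y s) ⟨hsub h3, hcurve Y hY s h3⟩)
  · filter_upwards [ae_restrict_mem measurableSet_Icc] with s hs
    have h1 : ContinuousOn (fun x : E q × E m => (s, x.2))
        (univ ×ˢ Metric.closedBall (yh t₀) δ) := continuousOn_const.prodMk continuousOn_snd
    have h2 : MapsTo (fun x : E q × E m => (s, x.2)) (univ ×ˢ Metric.closedBall (yh t₀) δ)
        (Icc t₀ (t₀ + ε) ×ˢ Metric.closedBall (yh t₀) δ) := fun x hx => mk_mem_prod (hsub hs) hx.2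
    have h5 : ContinuousOn (fun x : E q × E m => stateFeedback β N α ρ φ s x.2)
        (univ ×ˢ Metric.closedBall (yh t₀) δ) :=
      ContinuousOn.comp (g := fun x : ℝ × E m => stateFeedback β N α ρ φ x.1 x.2)
        (f := fun x : E q × E m => (s, x.2)) hUc h1 h2
    have h3 : ContinuousOn (fun x : E q × E m => D s + stateFeedback β N α ρ φ s x.2)
        (univ ×ˢ Metric.closedBall (yh t₀) δ) :=
      (continuousOn_const (c := D s)).add h5
    have h4 : ContinuousOn (fun x : E q × E m => (d s, x.1, D s + stateFeedback β N α ρ φ s x.2))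
        (univ ×ˢ Metric.closedBall (yh t₀) δ) :=
      continuousOn_const.prodMk (continuousOn_fst.prodMk h3)
    exact H.sys.continuous.comp_continuousOn h4

/-- The Lipschitz hypothesis on the history passes to the continued curve, which makes the curve
absolutely continuous across the restart time `t₀`. -/
theorem exists_local_solution (H : IsFunnelProblem σ d F T y₀ D β N α ρ φ) {t₀ : ℝ}
    (ht₀ : 0 ≤ t₀) {yh : ℝ → E m} (hyh : ContinuousOn yh (Icc (-σ) t₀)) {K : ℝ≥0}
    (hyhl : LipschitzOnWith K yh (Icc 0 t₀)) (hin : ‖normalizedError ρ φ yh t₀‖ < 1) :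
    ∃ t₁ > t₀, ∃ Y : ℝ → E m, ContinuousOn Y (Ici (-σ)) ∧ EqOn Y yh (Icc (-σ) t₀) ∧
      (∃ K' : ℝ≥0, LipschitzOnWith K' Y (Ici 0)) ∧
      (∀ t ∈ Icc t₀ t₁, ‖normalizedError ρ φ Y t‖ < 1) ∧
      ∀ᵐ t ∂volume.restrict (Icc t₀ t₁),
        HasDerivAt Y (F (d t, T Y t, D t + funnelInput β N α ρ φ Y t)) t := by
  obtain ⟨t₁, δ, M, c, HP, hball⟩ := H.exists_isLocalProblem ht₀ hyh hin
  obtain ⟨Y, hY, hYeq⟩ := HP.exists_solution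
  refine ⟨t₁, HP.lt, Y, hY.continuousOn, hY.eqOn, ?_, fun t ht => ?_,
    HP.ae_hasDerivAt hY hYeq⟩
  · have h1 : LipschitzOnWith (K * 1) (fun t => yh (min t t₀)) (Ici 0) :=
      hyhl.comp (f := fun t => min t t₀) ((LipschitzWith.id.min_const t₀).lipschitzOnWith)
        fun t ht => ⟨le_min ht ht₀, min_le_right _ _⟩
    have h2 := h1.add ((HP.lipschitzWith_primitive hY).lipschitzOnWith (s := Ici 0))
    refine ⟨K * 1 + M.toNNReal, fun t ht s hs => ?_⟩
    rw [hYeq t, hYeq s]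
    exact h2 ht hs
  · exact hball t ht _ (mem_closedBall_iff_norm.2 (hY.mem_ball t ht.1))

end IsFunnelProblem

/-! ### The repelling shell inside the funnel -/

/-- If `h t > 0`, let `a` be the last time before `t` with `h a ≤ 0`. Just after `a` the values lie
in `(0, η)`, where `h` cannot increase, so they would have to stay nonpositive. -/
theorem nonpos_of_ae_hasDerivAt_nonpos {h : ℝ → ℝ} {τ η : ℝ}
    (hac : AbsolutelyContinuousOnInterval h 0 τ) (hτ : 0 ≤ τ) (h0 : h 0 ≤ 0) (hη : 0 < η)
    (hd : ∀ᵐ t, t ∈ Ioo 0 τ → 0 < h t → h t < η → ∃ c ≤ 0, HasDerivAt h c t) :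
    ∀ t ∈ Icc 0 τ, h t ≤ 0 := by
  have hc : ContinuousOn h (Icc 0 τ) := by simpa [uIcc_of_le hτ] using hac.continuousOn
  intro t ht
  by_contra! hpos
  set S := Icc 0 t ∩ h ⁻¹' Iic 0 with hS
  have hct : ContinuousOn h (Icc 0 t) := hc.mono (Icc_subset_Icc_right ht.2)
  have hScl : IsClosed S := hct.preimage_isClosed_of_isClosed isClosed_Icc isClosed_Iic
  have hSne : S.Nonempty := ⟨0, ⟨le_rfl, ht.1⟩, h0⟩
  have hSbd : BddAbove S := ⟨t, fun s hs => hs.1.2⟩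
  obtain ⟨⟨ha0, hat⟩, hah⟩ := hScl.csSup_mem hSne hSbd
  set a := sSup S with ha
  have hah' : h a ≤ 0 := hah
  have hat' : a < t := lt_of_le_of_ne hat fun e => absurd hah' (by rw [e]; exact not_le.2 hpos)
  have hgt : ∀ s ∈ Ioc a t, 0 < h s := by
    intro s hs
    by_contra! hle
    exact absurd (le_csSup hSbd ⟨⟨ha0.trans hs.1.le, hs.2⟩, hle⟩) (not_le.2 hs.1)
  have hcw : ContinuousWithinAt h (Icc a t) a :=
    (hct a ⟨ha0, hat⟩).mono (Icc_subset_Icc_left ha0)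
  have hev : ∀ᶠ s in 𝓝[≥] a, h s < η := by
    rw [← nhdsWithin_Icc_eq_nhdsGE hat']
    exact hcw.eventually_lt_const (hah'.trans_lt hη)
  obtain ⟨u, hu, hus⟩ := mem_nhdsGE_iff_exists_Icc_subset.1 hev
  set b := min u t with hb
  have hab : a < b := lt_min hu hat'
  have hbt : b ≤ t := min_le_right _ _
  have hsub : uIcc a b ⊆ uIcc 0 τ := by
    rw [uIcc_of_le hab.le, uIcc_of_le hτ]
    exact Icc_subset_Icc ha0 (hbt.trans ht.2)
  have key := (hac.mono hsub).sub_le_of_ae_hasDerivAt_le (C := 0) hab.le (by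
    filter_upwards [hd] with s hs hsI
    exact hs ⟨ha0.trans_lt hsI.1, hsI.2.trans_le (hbt.trans ht.2)⟩
      (hgt s ⟨hsI.1, hsI.2.le.trans hbt⟩) (hus ⟨hsI.1.le, hsI.2.le.trans (min_le_left _ _)⟩))
  have := hgt b ⟨hab, hbt⟩
  linarith

theorem hasDerivAt_norm_comp {V : Type*} [NormedAddCommGroup V] [InnerProductSpace ℝ V]
    {e : ℝ → V} {e' : V} {t : ℝ} (he : HasDerivAt e e' t) (h0 : e t ≠ 0) :
    HasDerivAt (fun s => ‖e s‖) (inner ℝ (e t) e' / ‖e t‖) t := by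
  have h1 := he.norm_sq.sqrt (by simpa using h0)
  simp only [Real.sqrt_sq (norm_nonneg _)] at h1
  convert h1 using 1
  rw [mul_div_mul_left _ _ two_ne_zero]

theorem hasDerivAt_of_lipschitzOnWith {V : Type*} [NormedAddCommGroup V] [NormedSpace ℝ V]
    [FiniteDimensional ℝ V] {f : ℝ → V} {K : ℝ≥0} (hf : LipschitzOnWith K f (Ici 0)) :
    ∀ᵐ t, 0 < t → ∃ c, ‖c‖ ≤ K ∧ HasDerivAt f c t := by
  filter_upwards [hf.ae_differentiableWithinAt_of_mem_real] with t ht h0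
  have hn : Ici (0 : ℝ) ∈ 𝓝 t := Ici_mem_nhds h0
  exact ⟨deriv f t, norm_deriv_le_of_lipschitzOn hn hf,
    ((ht h0.le).differentiableAt hn).hasDerivAt⟩

namespace IsFunnelProblem

variable {p q m : ℕ} {σ : ℝ} {d : ℝ → E p} {F : E p × E q × E m → E m}
  {T : (ℝ → E m) → ℝ → E q} {y₀ D : ℝ → E m} {β N α : ℝ → ℝ} {ρ : ℝ → E m} {φ : ℝ → ℝ}

/-- The total gain attains every real value arbitrarily close to the funnel boundary. -/
theorem exists_gain_eq (H : IsFunnelProblem σ d F T y₀ D β N α ρ φ) {r₀ : ℝ} (h0 : 0 ≤ r₀)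
    (h1 : r₀ < 1) (s : ℝ) : ∃ r ∈ Ioo r₀ 1, β r * N (α (r ^ 2)) = s := by
  have hβ : ∀ᶠ r in 𝓝[≤] (1 : ℝ), β 1 / 2 < β r := by
    have h2 : Tendsto β (𝓝[Icc 0 1] 1) (𝓝 (β 1)) :=
      H.scale_continuousOn 1 ⟨zero_le_one, le_rfl⟩
    rw [nhdsWithin_Icc_eq_nhdsLE zero_lt_one] at h2
    exact h2.eventually_const_lt (half_lt_self H.scale_one_pos)
  obtain ⟨l, hl, hlβ⟩ := mem_nhdsLE_iff_exists_Icc_subset.1 hβ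
  have hl' : l < 1 := hl
  set r₁ := max r₀ l with hr₁
  have hr₁0 : 0 ≤ r₁ := h0.trans (le_max_left _ _)
  have hr₁1 : r₁ < 1 := max_lt h1 hl'
  have hcomp : MapsTo (fun r : ℝ => r ^ 2) (Icc 0 r₁) (Ico 0 1) := fun r hr =>
    ⟨sq_nonneg r, pow_lt_one₀ hr.1 (hr.2.trans_lt hr₁1) two_ne_zero⟩
  have hNα : ContinuousOn (fun r => N (α (r ^ 2))) (Icc 0 r₁) :=
    H.switch_continuousOn.comp (H.gain_continuousOn.comp (by fun_prop) hcomp) fun r hr =>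
      mem_Ici.2 (zero_le_one.trans (H.gain_bijOn.mapsTo (hcomp hr)))
  obtain ⟨B, hB⟩ := isCompact_Icc.exists_bound_of_continuousOn hNα
  obtain ⟨B', hB'⟩ := (isCompact_Icc (a := (0 : ℝ)) (b := 1)).exists_bound_of_continuousOn
    (H.switch_continuousOn.mono Icc_subset_Ici_self)
  -- Values larger than `B'` are not taken by `N` on `[0, 1]`, hence are taken within the range of
  -- `α`; those larger than `B` are not taken for `r ≤ r₁`. What remains is `r` close to `1`.
  have hex : ∀ V : ℝ, max B B' < |V| → ∃ r ∈ Ioo r₁ 1, N (α (r ^ 2)) = V := by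
    intro V hV
    obtain ⟨x, hx, hxV⟩ := H.switch_surjOn (mem_univ V)
    have hx1 : 1 ≤ x := by
      by_contra! hlt
      have := hB' x ⟨hx, hlt.le⟩
      rw [hxV, Real.norm_eq_abs] at this
      linarith [le_max_right B B']
    obtain ⟨a, ha, hax⟩ := H.gain_bijOn.surjOn (mem_Ici.2 hx1)
    have hsq : √a ^ 2 = a := Real.sq_sqrt ha.1
    refine ⟨√a, ⟨?_, ?_⟩, by rw [hsq, hax, hxV]⟩
    · by_contra! hle
      have := hB (√a) ⟨Real.sqrt_nonneg a, hle⟩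
      rw [hsq, hax, hxV, Real.norm_eq_abs] at this
      linarith [le_max_left B B']
    · rw [Real.sqrt_lt' one_pos]
      simpa using ha.2
  -- Large enough for `hex` at `W` and `-W`, and, since `β > β(1)/2` on the shell, for `β(r) W ≥
  -- |s|`. The gain thus lies on both sides of `s`.
  set W := max (max B B') 0 + 1 + 2 * |s| / β 1 with hW
  have hβ1 := H.scale_one_pos
  have hdiv : 0 ≤ 2 * |s| / β 1 := by positivity
  have hW0 : 0 < W := by
    have := le_max_right (max B B') 0
    linarith
  have hWB : max B B' < |W| := by
    rw [abs_of_pos hW0]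
    have := le_max_left (max B B') 0
    linarith
  have hβW : ∀ r ∈ Ioo r₁ 1, |s| ≤ β r * W := by
    intro r hr
    have h2 : β 1 / 2 < β r := hlβ ⟨(le_max_right _ _).trans hr.1.le, hr.2.le⟩
    calc |s| = β 1 / 2 * (2 * |s| / β 1) := by field_simp
      _ ≤ β r * W := by
        refine mul_le_mul h2.le ?_ hdiv ((half_pos hβ1).trans h2).le
        have := le_max_right (max B B') 0
        linarith
  obtain ⟨a, ha, haW⟩ := hex W hWB
  obtain ⟨b, hb, hbW⟩ := hex (-W) (by rwa [abs_neg])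
  have hsub : uIcc b a ⊆ Ioo r₁ 1 := ordConnected_Ioo.uIcc_subset hb ha
  have hivt := intermediate_value_uIcc (H.continuousOn_gain.mono
    (hsub.trans fun r hr => ⟨hr₁0.trans hr.1.le, hr.2⟩))
  obtain ⟨r, hr, hrs⟩ := hivt (show s ∈ _ by
    refine Icc_subset_uIcc ⟨?_, ?_⟩
    · rw [hbW, mul_neg]
      linarith [hβW b hb, neg_abs_le s]
    · rw [haW]
      linarith [hβW a ha, le_abs_self s])
  exact ⟨r, ⟨(le_max_left _ _).trans_lt (hsub hr).1, (hsub hr).2⟩, hrs⟩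

theorem exists_inner_lt (hF : PerturbationHighGain F) {Kp : Set (E p)} {Kq : Set (E q)}
    {Km : Set (E m)} (hp : IsCompact Kp) (hq : IsCompact Kq) (hm : IsCompact Km) (M : ℝ) :
    ∃ ν ∈ Ioo (0 : ℝ) 1, ∃ s : ℝ, ∀ δ ∈ Kp, ∀ z ∈ Kq, ∀ Δ ∈ Km, ∀ v : E m, ν ≤ ‖v‖ → ‖v‖ ≤ 1 →
      M < inner ℝ v (F (δ, z, Δ - s • v)) := by
  obtain ⟨ν, hν, h⟩ := hF Km hm
  obtain ⟨s, hs⟩ := lt_iSup_iff.1 ((h Kp Kq hp hq) ▸ EReal.coe_lt_top M)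
  refine ⟨ν, hν, s, fun δ hδ z hz Δ hΔ v hv1 hv2 => EReal.coe_lt_coe_iff.1 (hs.trans_le ?_)⟩
  exact iInf₂_le_of_le δ hδ <| iInf₂_le_of_le z hz <| iInf₂_le_of_le Δ hΔ <|
    iInf₂_le_of_le v ⟨hv1, hv2⟩ le_rfl

/-- The high-gain estimate at `s` is a strict inequality on a compact set, so it persists for gains
near `s`. Choosing `r` with total gain exactly `s` and using continuity of the gain gives the width
`η`. -/
theorem exists_repelling_shell (H : IsFunnelProblem σ d F T y₀ D β N α ρ φ) {Kp : Set (E p)}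
    {Kq : Set (E q)} {Km : Set (E m)} (hp : IsCompact Kp) (hq : IsCompact Kq) (hm : IsCompact Km)
    (M : ℝ) {r₀ : ℝ} (h1 : r₀ < 1) :
    ∃ r, r₀ < r ∧ 0 < r ∧ r < 1 ∧ ∃ η > 0, ∀ w : E m, r ≤ ‖w‖ → ‖w‖ < r + η → ‖w‖ < 1 ∧
      ∀ δ ∈ Kp, ∀ z ∈ Kq, ∀ Δ ∈ Km, inner ℝ w (F (δ, z, Δ + feedback β N α w)) ≤ -M := by
  obtain ⟨ν, hν, s, hs⟩ := exists_inner_lt H.sys.highGain hp hq hm M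
  obtain ⟨r, hr, hrs⟩ := H.exists_gain_eq (hν.1.le.trans (le_max_right r₀ ν)) (max_lt h1 hν.2) s
  have hr0 : 0 < r := hν.1.trans ((le_max_right _ _).trans_lt hr.1)
  have hV : IsCompact {v : E m | ν ≤ ‖v‖ ∧ ‖v‖ ≤ 1} := by
    refine (isCompact_closedBall (0 : E m) 1).of_isClosed_subset ?_
      fun v hv => mem_closedBall_zero_iff.2 hv.2
    exact (isClosed_le continuous_const continuous_norm).inter
      (isClosed_le continuous_norm continuous_const)
  have hK := hp.prod (hq.prod (hm.prod hV))
  have hFc := H.sys.continuous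
  have hev : ∀ᶠ s' in 𝓝 s, ∀ x ∈ Kp ×ˢ Kq ×ˢ Km ×ˢ {v : E m | ν ≤ ‖v‖ ∧ ‖v‖ ≤ 1},
      M < inner ℝ x.2.2.2 (F (x.1, x.2.1, x.2.2.1 - s' • x.2.2.2)) := by
    refine hK.eventually_forall_of_forall_eventually fun x hx => ?_
    have hcont : Continuous fun z : ℝ × (E p × E q × E m × E m) =>
        (inner ℝ z.2.2.2.2 (F (z.2.1, z.2.2.1, z.2.2.2.1 - z.1 • z.2.2.2.2)) : ℝ) := by fun_prop
    exact (hcont.tendsto (s, x)).eventually_const_lt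
      (hs _ hx.1 _ hx.2.1 _ hx.2.2.1 _ hx.2.2.2.1 hx.2.2.2.2)
  have hk : ContinuousAt (fun r => β r * N (α (r ^ 2))) r :=
    H.continuousOn_gain.continuousAt (Ico_mem_nhds hr0 hr.2)
  rw [← hrs] at hev
  obtain ⟨η, hη, hball⟩ := Metric.eventually_nhds_iff.1
    ((hk.eventually hev).and (eventually_lt_nhds hr.2))
  refine ⟨r, (le_max_left _ _).trans_lt hr.1, hr0, hr.2, η, hη, fun w hw1 hw2 => ?_⟩
  obtain ⟨h2, h3⟩ := hball (y := ‖w‖) (by rw [Real.dist_eq, abs_of_nonneg] <;> linarith)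
  refine ⟨h3, fun δ hδ z hz Δ hΔ => ?_⟩
  -- With `v = -w` the argument `Δ - s' v` becomes `Δ` plus the feedback at `w`, and the lower bound
  -- turns into an upper bound for the pairing with `w`.
  have h4 := h2 (δ, z, Δ, -w) (mk_mem_prod hδ (mk_mem_prod hz (mk_mem_prod hΔ
    ⟨by rw [norm_neg]; exact ((le_max_right _ _).trans hr.1.le).trans hw1,
     by rw [norm_neg]; exact h3.le⟩)))
  simp only [smul_neg, sub_neg_eq_add, inner_neg_left] at h4
  rw [feedback]
  linarith


variable {ω : EReal} {y : ℝ → E m}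

/-! ### A priori bounds uniform over all solutions -/

theorem continuousOn_solution (H : IsFunnelProblem σ d F T y₀ D β N α ρ φ)
    (S : IsClosedLoopSolution σ d F T y₀ D β N α ρ φ ω y) {τ : ℝ} (hτ : 0 < τ)
    (hτω : (τ : EReal) < ω) : ContinuousOn y (Icc (-σ) τ) := by
  have h1 : ContinuousOn y (Icc (-σ) 0) := H.history.congr S.solution.initial
  have h2 : ContinuousOn y (Icc 0 τ) := by
    simpa [uIcc_of_le hτ.le] using (S.solution.absCont τ hτ hτω).continuousOn
  have h3 := h1.union_of_isClosed h2 isClosed_Icc isClosed_Icc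
  rwa [Icc_union_Icc_eq_Icc (by linarith [H.sys.memory_nonneg]) hτ.le] at h3

/-- Freezing `y` at time `τ` is the standard extension to which `T` is applied; it inherits every
bound on `y`. -/
theorem continuousOn_freeze (H : IsFunnelProblem σ d F T y₀ D β N α ρ φ)
    (S : IsClosedLoopSolution σ d F T y₀ D β N α ρ φ ω y) {τ : ℝ} (hτ : 0 < τ)
    (hτω : (τ : EReal) < ω) : ContinuousOn (fun t => y (min t τ)) (Ici (-σ)) := by
  refine (H.continuousOn_solution S hτ hτω).comp (by fun_prop) fun t ht =>
    ⟨le_min ht ?_, min_le_right _ _⟩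
  linarith [H.sys.memory_nonneg]

theorem eqOn_freeze (σ : ℝ) (y : ℝ → E m) (τ : ℝ) :
    EqOn (fun t => y (min t τ)) y (Icc (-σ) τ) := fun t ht => by
  simp only [min_eq_left ht.2]

theorem norm_sub_reference_le (H : IsFunnelProblem σ d F T y₀ D β N α ρ φ)
    (S : IsClosedLoopSolution σ d F T y₀ D β N α ρ φ ω y) {t : ℝ} (ht : 0 ≤ t)
    (htω : (t : EReal) < ω) : ‖y t - ρ t‖ ≤ φ t := by
  obtain ⟨τ, hτ, hτω⟩ := EReal.lt_iff_exists_real_btwn.1 htω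
  have hτ' : t < τ := EReal.coe_lt_coe_iff.1 hτ
  have h0 : 0 < τ := ht.trans_lt hτ'
  have hsub : Icc 0 τ ⊆ Ici 0 := Icc_subset_Ici_self
  refine le_on_of_ae_le (s := Icc 0 τ) (f := fun t => ‖y t - ρ t‖) ?_ ?_ ?_ ?_ t ⟨ht, hτ'.le⟩
  · rw [interior_Icc, closure_Ioo h0.ne]
  · exact (((H.continuousOn_solution S h0 hτω).mono (Icc_subset_Icc_left
      (by linarith [H.sys.memory_nonneg]))).sub (H.reference.continuousOn.mono hsub)).norm
  · exact H.funnel.memW1Inf.continuousOn.mono hsub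
  · rw [ae_restrict_iff' measurableSet_Icc]
    filter_upwards [S.defined] with s hs hsI
    have h1 := hs hsI.1 ((EReal.coe_le_coe_iff.2 hsI.2).trans_lt hτω)
    rw [norm_normalizedError H.funnel hsI.1, div_lt_one (H.funnel.pos hsI.1)] at h1
    exact h1.le

theorem exists_solution_bound (H : IsFunnelProblem σ d F T y₀ D β N α ρ φ) :
    ∃ C : ℝ, 0 < C ∧ ∀ ω y, IsClosedLoopSolution σ d F T y₀ D β N α ρ φ ω y →
      ∀ t, -σ ≤ t → (t : EReal) < ω → ‖y t‖ ≤ C := by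
  obtain ⟨C₀, h₀⟩ := isCompact_Icc.exists_bound_of_continuousOn H.history
  obtain ⟨Cρ, hρ⟩ := H.reference.exists_norm_le
  obtain ⟨Cφ, hφ⟩ := H.funnel.memW1Inf.exists_norm_le
  refine ⟨max (max C₀ (Cφ + Cρ)) 1, by positivity, fun ω y S t ht htω => ?_⟩
  refine le_trans ?_ (le_max_left _ _)
  rcases le_total t 0 with h | h
  · rw [S.solution.initial ⟨ht, h⟩]
    exact (h₀ t ⟨ht, h⟩).trans (le_max_left _ _)
  · refine le_trans ?_ (le_max_right _ _)
    have h1 := H.norm_sub_reference_le S h htω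
    have h2 := norm_add_le (y t - ρ t) (ρ t)
    rw [sub_add_cancel] at h2
    linarith [hρ t h, (le_abs_self (φ t)).trans (hφ t h)]

/-- BIBO for the frozen solution, transferred to any other extension by causality. Only `‖w‖ ≤ 1` is
needed, so `R` may enter the choice of the barrier without circularity. -/
theorem exists_operator_bound (H : IsFunnelProblem σ d F T y₀ D β N α ρ φ) :
    ∃ R : ℝ, ∀ ω y, IsClosedLoopSolution σ d F T y₀ D β N α ρ φ ω y →
      ∀ τ : ℝ, 0 < τ → (τ : EReal) < ω → ∀ Y : ℝ → E m, ContinuousOn Y (Ici (-σ)) →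
        EqOn Y y (Icc (-σ) τ) → ∀ᵐ t ∂volume.restrict (Icc 0 τ), ‖T Y t‖ ≤ R := by
  obtain ⟨C, hC, hyC⟩ := H.exists_solution_bound
  obtain ⟨R, -, hR⟩ := H.sys.operator.bibo C hC
  refine ⟨R, fun ω y S τ hτ hτω Y hY hYy => ?_⟩
  have h1 := hR _ (H.continuousOn_freeze S hτ hτω) fun t ht => hyC ω y S _
    (le_min ht (by linarith [H.sys.memory_nonneg]))
    ((EReal.coe_le_coe_iff.2 (min_le_right t τ)).trans_lt hτω)
  have h2 := H.sys.operator.causal _ _ hY (H.continuousOn_freeze S hτ hτω) τ hτ.le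
    (hYy.trans (eqOn_freeze σ y τ).symm)
  filter_upwards [h2, ae_restrict_of_ae_restrict_of_subset Icc_subset_Ici_self h1] with t h3 h4
  rwa [h3]

/-- The derivative is `⟨w, y' - ρ'⟩ / ‖w‖ - r φ'`. The first pairing contributes at most `-(Lρ +
Lφ)` because `‖w‖ ≤ 1`, and this absorbs the motion of `ρ` and `φ`. -/
theorem hasDerivAt_barrier_nonpos (hφ : IsFunnelFunction φ) {t r Lρ Lφ : ℝ} (ht : 0 ≤ t)
    (hr : 0 < r) (hr1 : r ≤ 1) {y' ρ' : E m} {φ' : ℝ} (hy : HasDerivAt y y' t)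
    (hρ' : HasDerivAt ρ ρ' t) (hφ' : HasDerivAt φ φ' t) (hLρ : ‖ρ'‖ ≤ Lρ) (hLφ : ‖φ'‖ ≤ Lφ)
    (hout : r ≤ ‖normalizedError ρ φ y t‖) (hin : ‖normalizedError ρ φ y t‖ ≤ 1)
    (hinner : inner ℝ (normalizedError ρ φ y t) y' ≤ -(Lρ + Lφ)) :
    ∃ c ≤ 0, HasDerivAt (fun s => ‖y s - ρ s‖ - r * φ s) c t := by
  have hφpos := hφ.pos ht
  have hw := norm_normalizedError (ρ := ρ) (y := y) hφ ht
  set w := normalizedError ρ φ y t with hwdef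
  have hwpos : 0 < ‖w‖ := hr.trans_le hout
  have he : y t - ρ t = φ t • w := by
    rw [hwdef, normalizedError, smul_smul, mul_inv_cancel₀ hφpos.ne', one_smul]
  have hnorm : ‖y t - ρ t‖ = φ t * ‖w‖ := by
    rw [he, norm_smul, Real.norm_of_nonneg hφpos.le]
  have hne : y t - ρ t ≠ 0 := by
    rw [← norm_pos_iff, hnorm]
    positivity
  refine ⟨_, ?_, (hasDerivAt_norm_comp (hy.sub hρ') hne).sub (hφ'.const_mul r)⟩
  have h1 : inner ℝ ((y - ρ) t) (y' - ρ') / ‖(y - ρ) t‖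
      = inner ℝ w y' / ‖w‖ - inner ℝ w ρ' / ‖w‖ := by
    rw [Pi.sub_apply, hnorm, he, inner_smul_left, inner_sub_right]
    simp only [RCLike.conj_to_real]
    field_simp
  have hL : 0 ≤ Lρ + Lφ := by linarith [norm_nonneg ρ', norm_nonneg φ']
  have h2 : inner ℝ w y' / ‖w‖ ≤ -(Lρ + Lφ) := by
    rw [div_le_iff₀ hwpos]
    nlinarith
  have h3 : -(inner ℝ w ρ' / ‖w‖) ≤ Lρ := by
    rw [← neg_div, div_le_iff₀ hwpos]
    have := abs_real_inner_le_norm w ρ'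
    have := neg_abs_le (inner ℝ w ρ')
    nlinarith
  have h4 : -(r * φ') ≤ Lφ := by
    have h5 : |φ'| ≤ Lφ := hLφ
    have := neg_abs_le φ'
    nlinarith [abs_nonneg φ']
  rw [h1]
  linarith

theorem exists_barrier (H : IsFunnelProblem σ d F T y₀ D β N α ρ φ) :
    ∃ r : ℝ, 0 < r ∧ r < 1 ∧ ∀ ω y, IsClosedLoopSolution σ d F T y₀ D β N α ρ φ ω y →
      ∀ t : ℝ, 0 ≤ t → (t : EReal) < ω → ‖normalizedError ρ φ y t‖ ≤ r := by
  obtain ⟨R, hR⟩ := H.exists_operator_bound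
  obtain ⟨Cd, -, hCd⟩ := ae_norm_le_of_memLp_top H.sys.disturbance
  obtain ⟨CD, -, hCD⟩ := ae_norm_le_of_memLp_top H.input_disturbance
  obtain ⟨Lρ, hLρ⟩ := H.reference.exists_lipschitzOnWith
  obtain ⟨Lφ, hLφ⟩ := H.funnel.memW1Inf.exists_lipschitzOnWith
  obtain ⟨ε, hε, hεφ⟩ := H.funnel.exists_pos_le
  have hφ0 : 0 < φ 0 := H.funnel.pos le_rfl
  have hr₀ : ‖y₀ 0 - ρ 0‖ / φ 0 < 1 := (div_lt_one hφ0).2 H.initial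
  obtain ⟨r, hr, hr0, hr1, η, hη, hshell⟩ := H.exists_repelling_shell
    (isCompact_closedBall (0 : E p) Cd) (isCompact_closedBall (0 : E q) R)
    (isCompact_closedBall (0 : E m) CD) (Lρ + Lφ) hr₀
  refine ⟨r, hr0, hr1, fun ω y S t ht htω => ?_⟩
  obtain ⟨τ, hτ, hτω⟩ := EReal.lt_iff_exists_real_btwn.1 htω
  have hτ' : t < τ := EReal.coe_lt_coe_iff.1 hτ
  have h0 : 0 < τ := ht.trans_lt hτ'
  have hsub : uIcc 0 τ ⊆ Ici 0 := by rw [uIcc_of_le h0.le]; exact Icc_subset_Ici_self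
  have hac : AbsolutelyContinuousOnInterval (fun s => ‖y s - ρ s‖ - r * φ s) 0 τ :=
    ((S.solution.absCont τ h0 hτω).sub
      (hLρ.mono hsub).absolutelyContinuousOnInterval).lipschitz_comp lipschitzWith_one_norm
      |>.sub ((hLφ.mono hsub).absolutelyContinuousOnInterval.const_mul r)
  have hinit : ‖y 0 - ρ 0‖ - r * φ 0 ≤ 0 := by
    rw [S.solution.initial ⟨by linarith [H.sys.memory_nonneg], le_rfl⟩]
    rw [div_lt_iff₀ hφ0] at hr
    linarith
  -- Since `φ ≥ ε`, a value of `‖y - ρ‖ - rφ` in `(0, η ε)` forces `r < ‖w‖ < r + η`.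
  have hmain := nonpos_of_ae_hasDerivAt_nonpos hac h0.le hinit (mul_pos hη hε) (by
    have hfreeze := H.continuousOn_freeze S h0 hτω
    have h1 := (ae_restrict_iff' measurableSet_Icc).1
      (S.solution.equation τ h0 hτω _ hfreeze (eqOn_freeze σ y τ))
    have h2 := (ae_restrict_iff' measurableSet_Icc).1
      (hR ω y S τ h0 hτω _ hfreeze (eqOn_freeze σ y τ))
    filter_upwards [h1, h2, (ae_restrict_iff' measurableSet_Ici).1 hCd,
      (ae_restrict_iff' measurableSet_Ici).1 hCD, hasDerivAt_of_lipschitzOnWith hLρ,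
      hasDerivAt_of_lipschitzOnWith hLφ] with s h1 h2 h3 h4 h5 h6 hs hpos hlt
    have hsI : s ∈ Icc 0 τ := Ioo_subset_Icc_self hs
    have hφs := H.funnel.pos hs.1.le
    obtain ⟨ρ', hρ', hdρ⟩ := h5 hs.1
    obtain ⟨φ', hφ', hdφ⟩ := h6 hs.1
    have hw := norm_normalizedError (ρ := ρ) (y := y) H.funnel hs.1.le
    have hw1 : r ≤ ‖normalizedError ρ φ y s‖ := by
      rw [hw, le_div_iff₀ hφs]
      linarith
    have hw2 : ‖normalizedError ρ φ y s‖ < r + η := by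
      rw [hw, div_lt_iff₀ hφs]
      have := hεφ s hs.1.le
      nlinarith
    obtain ⟨hw3, hw4⟩ := hshell _ hw1 hw2
    exact hasDerivAt_barrier_nonpos H.funnel hs.1.le hr0 hr1.le (h1 hsI) hdρ hdφ hρ' hφ'
      hw1 hw3.le (hw4 _ (mem_closedBall_zero_iff.2 (h3 hs.1.le)) _
        (mem_closedBall_zero_iff.2 (h2 hsI)) _ (mem_closedBall_zero_iff.2 (h4 hs.1.le))))
  have h7 := hmain t ⟨ht, hτ'.le⟩
  rw [norm_normalizedError H.funnel ht, div_le_iff₀ (H.funnel.pos ht)]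
  linarith

theorem exists_lipschitz_bound (H : IsFunnelProblem σ d F T y₀ D β N α ρ φ) :
    ∃ L : ℝ≥0, ∀ ω y, IsClosedLoopSolution σ d F T y₀ D β N α ρ φ ω y →
      LipschitzOnWith L y {t | 0 ≤ t ∧ (t : EReal) < ω} := by
  obtain ⟨R, hR⟩ := H.exists_operator_bound
  obtain ⟨r, hr0, hr1, hbar⟩ := H.exists_barrier
  obtain ⟨CU, hCU⟩ := (isCompact_closedBall (0 : E m) r).exists_bound_of_continuousOn
    (H.continuousOn_feedback.mono (Metric.closedBall_subset_ball hr1))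
  obtain ⟨M, hM0, hM⟩ := H.exists_field_bound R CU
  refine ⟨M.toNNReal, fun ω y S => ?_⟩
  have key : ∀ a b : ℝ, 0 ≤ a → a ≤ b → (b : EReal) < ω → dist (y a) (y b) ≤ M * dist a b := by
    intro a b ha hab hbω
    rcases hab.eq_or_lt with rfl | hab'
    · simp
    have hb : 0 < b := ha.trans_lt hab'
    have hfreeze := H.continuousOn_freeze S hb hbω
    have h1 := (ae_restrict_iff' measurableSet_Icc).1
      (S.solution.equation b hb hbω _ hfreeze (eqOn_freeze σ y b))
    have h2 := (ae_restrict_iff' measurableSet_Icc).1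
      (hR ω y S b hb hbω _ hfreeze (eqOn_freeze σ y b))
    have hac := (S.solution.absCont b hb hbω).mono (c := a) (d := b) (by
      rw [uIcc_of_le hab, uIcc_of_le hb.le]
      exact Icc_subset_Icc_left ha)
    rw [dist_comm, dist_eq_norm, dist_comm, Real.dist_eq, abs_of_nonneg (by linarith)]
    refine hac.norm_sub_le_of_ae_hasDerivAt hab ?_
    filter_upwards [h1, h2, (ae_restrict_iff' measurableSet_Ici).1 hM] with s h1 h2 h3 hs
    have hs0 : 0 ≤ s := ha.trans hs.1.le
    have hsI : s ∈ Icc 0 b := ⟨hs0, hs.2.le⟩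
    exact ⟨_, h3 hs0 _ _ (h2 hsI) (hCU _ (mem_closedBall_zero_iff.2 (hbar ω y S s hs0
      ((EReal.coe_lt_coe_iff.2 hs.2).trans hbω)))), h1 hsI⟩
  refine LipschitzOnWith.of_dist_le_mul fun a ha b hb => ?_
  rw [Real.coe_toNNReal M hM0]
  rcases le_total a b with hab | hab
  · exact key a b ha.1 hab hb.2
  · rw [dist_comm (y a), dist_comm a]
    exact key b a hb.1 hab ha.2

end IsFunnelProblem

/-! ### Gluing, continuation and maximal solutions -/

theorem _root_.AbsolutelyContinuousOnInterval.congr_eqOn {X : Type*} [PseudoMetricSpace X]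
    {f g : ℝ → X} {a b : ℝ} (hf : AbsolutelyContinuousOnInterval f a b)
    (h : EqOn f g (uIcc a b)) : AbsolutelyContinuousOnInterval g a b := by
  rw [absolutelyContinuousOnInterval_iff] at hf ⊢
  intro ε hε
  obtain ⟨δ, hδ, hfδ⟩ := hf ε hε
  refine ⟨δ, hδ, fun I hI hIδ => ?_⟩
  have h1 : ∑ i ∈ Finset.range I.1, dist (g (I.2 i).1) (g (I.2 i).2)
      = ∑ i ∈ Finset.range I.1, dist (f (I.2 i).1) (f (I.2 i).2) :=
    Finset.sum_congr rfl fun i hi => by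
      rw [h (hI.1 i hi).1, h (hI.1 i hi).2]
  rw [h1]
  exact hfδ I hI hIδ

theorem ae_of_forall_ae_restrict_Icc {P : ℝ → Prop} {ω : EReal}
    (h : ∀ τ : ℝ, 0 < τ → (τ : EReal) < ω → ∀ᵐ t ∂volume.restrict (Icc 0 τ), P t) :
    ∀ᵐ t : ℝ, 0 ≤ t → (t : EReal) < ω → P t := by
  have h1 : ∀ c : ℚ, ∀ᵐ t : ℝ, 0 < (c : ℝ) → ((c : ℝ) : EReal) < ω → t ∈ Icc 0 (c : ℝ) → P t := by
    intro c
    by_cases hc : 0 < (c : ℝ) ∧ ((c : ℝ) : EReal) < ω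
    · filter_upwards [(ae_restrict_iff' measurableSet_Icc).1 (h c hc.1 hc.2)] with t ht _ _ using ht
    · exact Eventually.of_forall fun t h1 h2 => absurd ⟨h1, h2⟩ hc
  filter_upwards [ae_all_iff.2 h1] with t ht h0 htω
  obtain ⟨c, hc, hcω⟩ := EReal.lt_iff_exists_rat_btwn.1 htω
  have hc' : t < c := EReal.coe_lt_coe_iff.1 hc
  exact ht c (h0.trans_lt hc') hcω ⟨h0, hc'.le⟩

theorem normalizedError_congr {m : ℕ} {ρ y z : ℝ → E m} {φ : ℝ → ℝ} {t : ℝ} (h : y t = z t) :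
    normalizedError ρ φ y t = normalizedError ρ φ z t := by
  rw [normalizedError, normalizedError, h]

theorem funnelInput_congr {m : ℕ} {β N α : ℝ → ℝ} {ρ y z : ℝ → E m} {φ : ℝ → ℝ} {t : ℝ}
    (h : y t = z t) : funnelInput β N α ρ φ y t = funnelInput β N α ρ φ z t := by
  rw [funnelInput, funnelInput, normalizedError_congr h]

namespace IsFunnelProblem

variable {p q m : ℕ} {σ : ℝ} {d : ℝ → E p} {F : E p × E q × E m → E m}
  {T : (ℝ → E m) → ℝ → E q} {y₀ D : ℝ → E m} {β N α : ℝ → ℝ} {ρ : ℝ → E m} {φ : ℝ → ℝ}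
  {ω : EReal} {y : ℝ → E m}

/-- Being a solution is a local property. -/
theorem isClosedLoopSolution_of_forall_lt (H : IsFunnelProblem σ d F T y₀ D β N α ρ φ)
    {z : ℝ → E m} (hω : 0 < ω)
    (h : ∀ τ : ℝ, 0 < τ → (τ : EReal) < ω → ∃ ω' y,
      IsClosedLoopSolution σ d F T y₀ D β N α ρ φ ω' y ∧ (τ : EReal) < ω' ∧ ∀ t : ℝ, -σ ≤ t → (t : EReal) < ω' → z t = y t) :
    IsClosedLoopSolution σ d F T y₀ D β N α ρ φ ω z := by
  have hσ := H.sys.memory_nonneg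
  constructor
  · refine ae_of_forall_ae_restrict_Icc fun τ hτ hτω => ?_
    obtain ⟨ω', y, S, hτ', hzy⟩ := h τ hτ hτω
    rw [ae_restrict_iff' measurableSet_Icc]
    filter_upwards [S.defined] with t ht htI
    have htω' := (EReal.coe_le_coe_iff.2 htI.2).trans_lt hτ'
    rw [normalizedError_congr (hzy t (by linarith [htI.1]) htω')]
    exact ht htI.1 htω'
  · refine ⟨hω, ?_, fun τ hτ hτω => ?_, fun τ hτ hτω Y hY hYz => ?_⟩
    · obtain ⟨τ, hτ, hτω⟩ := EReal.lt_iff_exists_real_btwn.1 hω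
      have hτ0 : 0 < τ := EReal.coe_lt_coe_iff.1 hτ
      obtain ⟨ω', y, S, hτ', hzy⟩ := h τ hτ0 hτω
      intro t ht
      rw [hzy t ht.1 ((EReal.coe_le_coe_iff.2 (ht.2.trans hτ0.le)).trans_lt hτ')]
      exact S.solution.initial ht
    · obtain ⟨ω', y, S, hτ', hzy⟩ := h τ hτ hτω
      refine (S.solution.absCont τ hτ hτ').congr_eqOn fun t ht => ?_
      rw [uIcc_of_le hτ.le] at ht
      exact (hzy t (by linarith [ht.1]) ((EReal.coe_le_coe_iff.2 ht.2).trans_lt hτ')).symm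
    · obtain ⟨ω', y, S, hτ', hzy⟩ := h τ hτ hτω
      have hzy' : EqOn z y (Icc (-σ) τ) := fun t ht =>
        hzy t ht.1 ((EReal.coe_le_coe_iff.2 ht.2).trans_lt hτ')
      have h1 := S.solution.equation τ hτ hτ' Y hY (hYz.trans hzy')
      rw [← restrict_Ioo_eq_restrict_Icc] at h1 ⊢
      filter_upwards [h1, ae_restrict_mem measurableSet_Ioo] with t ht htI
      rw [funnelInput_congr (hzy' ⟨by linarith [htI.1], htI.2.le⟩)]
      refine ht.congr_of_eventuallyEq ?_
      filter_upwards [isOpen_Ioo.mem_nhds htI] with s hs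
      exact hzy' ⟨by linarith [hs.1], hs.2.le⟩

theorem isClosedLoopSolution_of_lipschitz (H : IsFunnelProblem σ d F T y₀ D β N α ρ φ) {t₁ : ℝ}
    (ht₁ : 0 < t₁) {Y : ℝ → E m} (hY : ContinuousOn Y (Ici (-σ))) (hY0 : EqOn Y y₀ (Icc (-σ) 0))
    {K : ℝ≥0} (hYl : LipschitzOnWith K Y (Ici 0))
    (hin : ∀ t ∈ Icc 0 t₁, ‖normalizedError ρ φ Y t‖ < 1)
    (hd : ∀ᵐ t ∂volume.restrict (Icc 0 t₁),
      HasDerivAt Y (F (d t, T Y t, D t + funnelInput β N α ρ φ Y t)) t) :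
    IsClosedLoopSolution σ d F T y₀ D β N α ρ φ t₁ Y where
  defined := Eventually.of_forall fun t h0 h1 => hin t ⟨h0, (EReal.coe_lt_coe_iff.1 h1).le⟩
  solution :=
    { pos := EReal.coe_pos.2 ht₁
      initial := hY0
      absCont := fun τ hτ _ => (hYl.mono (by
        rw [uIcc_of_le hτ.le]; exact Icc_subset_Ici_self)).absolutelyContinuousOnInterval
      equation := fun τ hτ hτω Z hZ hZY => by
        have h1 := H.sys.operator.causal Z Y hZ hY τ hτ.le hZY
        have h2 := ae_restrict_of_ae_restrict_of_subset
          (Icc_subset_Icc_right (EReal.coe_lt_coe_iff.1 hτω).le) hd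
        filter_upwards [h1, h2] with t h3 h4
        rw [h3]
        exact h4 }

theorem exists_closedLoopSolution (H : IsFunnelProblem σ d F T y₀ D β N α ρ φ) :
    ∃ (ω : EReal) (y : ℝ → E m), IsClosedLoopSolution σ d F T y₀ D β N α ρ φ ω y := by
  have h0 : ‖normalizedError ρ φ y₀ 0‖ < 1 := by
    rw [norm_normalizedError H.funnel le_rfl, div_lt_one (H.funnel.pos le_rfl)]
    exact H.initial
  obtain ⟨t₁, ht₁, Y, hY, hYy, ⟨K, hK⟩, hin, hd⟩ :=
    -- At `t₀ = 0` the Lipschitz condition concerns the single point `0`; no regularity of `y₀`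
    -- beyond continuity is needed.
    H.exists_local_solution (K := 0) le_rfl H.history (by simp [LipschitzOnWith]) h0
  exact ⟨t₁, Y, H.isClosedLoopSolution_of_lipschitz ht₁ hY hYy hK hin hd⟩

/-- The uniform Lipschitz bound gives `y` a limit at `t₀`, the barrier passes to this limit as `‖w‖
≤ r < 1`, and the local existence theorem restarts from there. -/
theorem exists_extension (H : IsFunnelProblem σ d F T y₀ D β N α ρ φ) {t₀ : ℝ}
    (S : IsClosedLoopSolution σ d F T y₀ D β N α ρ φ t₀ y) :
    ∃ t₁ > t₀, ∃ Y, IsClosedLoopSolution σ d F T y₀ D β N α ρ φ t₁ Y ∧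
      ∀ t : ℝ, -σ ≤ t → t < t₀ → Y t = y t := by
  have hσ := H.sys.memory_nonneg
  have ht₀ : 0 < t₀ := EReal.coe_pos.1 S.solution.pos
  obtain ⟨r, hr0, hr1, hbar⟩ := H.exists_barrier
  obtain ⟨L, hL⟩ := H.exists_lipschitz_bound
  have hlt : ∀ t : ℝ, t < t₀ → (t : EReal) < t₀ := fun t ht => EReal.coe_lt_coe_iff.2 ht
  obtain ⟨g, hg, hyg⟩ := (hL _ _ S).extend_finite_dimension
  have hyg' : ∀ t, 0 ≤ t → t < t₀ → y t = g t := fun t h0 h1 => hyg ⟨h0, hlt t h1⟩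
  -- The value `y t₀` carries no information, as the solution lives on `[-σ, t₀)`; it is replaced by
  -- the limit.
  set yh : ℝ → E m := fun t => if t < t₀ then y t else g t with hyh
  have hyhy : ∀ t, t < t₀ → yh t = y t := fun t ht => if_pos ht
  have hyhg : EqOn yh g (Icc 0 t₀) := fun t ht => by
    by_cases h : t < t₀
    · rw [hyhy t h, hyg' t ht.1 h]
    · exact if_neg h
  have hyh0 : EqOn yh y₀ (Icc (-σ) 0) := fun t ht => by
    rw [hyhy t (ht.2.trans_lt ht₀)]
    exact S.solution.initial ht
  have hyhc : ContinuousOn yh (Icc (-σ) t₀) := by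
    have h3 := (H.history.congr hyh0).union_of_isClosed
      (hg.continuous.continuousOn.congr hyhg) isClosed_Icc isClosed_Icc
    rwa [Icc_union_Icc_eq_Icc (by linarith) ht₀.le] at h3
  have hyhl : LipschitzOnWith (lipschitzExtensionConstant (E m) * L) yh (Icc 0 t₀) :=
    fun t ht s hs => by
      rw [hyhg ht, hyhg hs]
      exact hg t s
  have hin₀ : ‖normalizedError ρ φ yh t₀‖ < 1 := by
    refine lt_of_le_of_lt ?_ hr1
    rw [norm_normalizedError H.funnel ht₀.le, div_le_iff₀ (H.funnel.pos ht₀.le),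
      hyhg ⟨ht₀.le, le_rfl⟩]
    refine le_on_of_ae_le (s := Icc 0 t₀) (f := fun t => ‖g t - ρ t‖) (b := fun t => r * φ t)
      ?_ ?_ ?_ ?_ t₀ ⟨ht₀.le, le_rfl⟩
    · rw [interior_Icc, closure_Ioo ht₀.ne]
    · exact (hg.continuous.continuousOn.sub
        (H.reference.continuousOn.mono Icc_subset_Ici_self)).norm
    · exact continuousOn_const.mul (H.funnel.memW1Inf.continuousOn.mono Icc_subset_Ici_self)
    · rw [← restrict_Ioo_eq_restrict_Icc]
      filter_upwards [ae_restrict_mem measurableSet_Ioo] with t ht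
      have h1 := hbar _ _ S t ht.1.le (hlt t ht.2)
      rw [norm_normalizedError H.funnel ht.1.le, div_le_iff₀ (H.funnel.pos ht.1.le)] at h1
      rwa [← hyg' t ht.1.le ht.2]
  obtain ⟨t₁, ht₁, Y, hY, hYy, ⟨K, hK⟩, hin, hd⟩ :=
    H.exists_local_solution ht₀.le hyhc hyhl hin₀
  have hYeq : ∀ t : ℝ, -σ ≤ t → t < t₀ → Y t = y t := fun t h1 h2 => by
    rw [hYy ⟨h1, h2.le⟩, hyhy t h2]
  refine ⟨t₁, ht₁, Y, H.isClosedLoopSolution_of_lipschitz (ht₀.trans ht₁) hY ?_ hK ?_ ?_, hYeq⟩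
  · exact fun t ht => (hYy ⟨ht.1, ht.2.trans ht₀.le⟩).trans (hyh0 ht)
  · intro t ht
    rcases lt_or_ge t t₀ with h | h
    · rw [normalizedError_congr (hYeq t (by linarith [ht.1]) h)]
      exact (hbar _ _ S t ht.1 (hlt t h)).trans_lt hr1
    · exact hin t ⟨h, ht.2⟩
  · rw [← Icc_union_Icc_eq_Icc ht₀.le ht₁.le, ae_restrict_union_iff]
    refine ⟨?_, hd⟩
    have h1 := ae_of_forall_ae_restrict_Icc fun τ hτ hτω =>
      S.solution.equation τ hτ hτω Y hY fun t ht =>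
        hYeq t ht.1 (ht.2.trans_lt (EReal.coe_lt_coe_iff.1 hτω))
    rw [← restrict_Ioo_eq_restrict_Icc, ae_restrict_iff' measurableSet_Ioo]
    filter_upwards [h1] with t h2 ht
    rw [funnelInput_congr (hYeq t (by linarith [ht.1]) ht.2)]
    refine (h2 ht.1.le (hlt t ht.2)).congr_of_eventuallyEq ?_
    filter_upwards [isOpen_Ioo.mem_nhds ht] with s hs
    exact hYeq s (by linarith [hs.1]) hs.2

theorem exists_maximal_extension (H : IsFunnelProblem σ d F T y₀ D β N α ρ φ)
    (S : IsClosedLoopSolution σ d F T y₀ D β N α ρ φ ω y) :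
    ∃ (ω' : EReal) (z : ℝ → E m), ω ≤ ω' ∧
      (∀ t : ℝ, -σ ≤ t → (t : EReal) < ω → z t = y t) ∧
      IsMaximalClosedLoopSolution σ d F T y₀ D β N α ρ φ ω' z := by
  -- Extension is only a preorder, since values beyond the end time are arbitrary; hence the form of
  -- Zorn's lemma for transitive relations.
  let r : EReal × (ℝ → E m) → EReal × (ℝ → E m) → Prop := fun a b =>
    a.1 ≤ b.1 ∧ ∀ t : ℝ, -σ ≤ t → (t : EReal) < a.1 → b.2 t = a.2 t
  have rtrans : ∀ {a b c}, r a b → r b c → r a c := fun {a b c} hab hbc =>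
    ⟨hab.1.trans hbc.1, fun t h1 h2 => (hbc.2 t h1 (h2.trans_le hab.1)).trans (hab.2 t h1 h2)⟩
  have rrefl : ∀ a, r a a := fun a => ⟨le_rfl, fun _ _ _ => rfl⟩
  let X := {a : EReal × (ℝ → E m) //
    IsClosedLoopSolution σ d F T y₀ D β N α ρ φ a.1 a.2 ∧ r (ω, y) a}
  have : Nonempty X := ⟨⟨(ω, y), S, rrefl _⟩⟩
  obtain ⟨M, hM⟩ := exists_maximal_of_nonempty_chains_bounded
    (r := fun a b : X => r a.1 b.1) (fun c hc hne => by
      classical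
      let Ω : EReal := ⨆ a ∈ c, a.1.1
      let z : ℝ → E m := fun t =>
        if h : ∃ a : X, a ∈ c ∧ (t : EReal) < a.1.1 then h.choose.1.2 t else 0
      have hz : ∀ a ∈ c, ∀ t : ℝ, -σ ≤ t → (t : EReal) < a.1.1 → z t = a.1.2 t := by
        intro a ha t ht hta
        have h : ∃ a : X, a ∈ c ∧ (t : EReal) < a.1.1 := ⟨a, ha, hta⟩
        have hz' : z t = h.choose.1.2 t := dif_pos h
        obtain ⟨hb, htb⟩ := h.choose_spec
        rw [hz']
        by_cases hab : a = h.choose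
        · rw [← hab]
        rcases hc ha hb hab with h1 | h1
        · exact h1.2 t ht hta
        · exact (h1.2 t ht htb).symm
      have hle : ∀ a ∈ c, a.1.1 ≤ Ω := fun a ha => le_iSup₂ (f := fun (a : X) _ => a.1.1) a ha
      obtain ⟨a₀, ha₀⟩ := hne
      have hsol : IsClosedLoopSolution σ d F T y₀ D β N α ρ φ Ω z := by
        refine H.isClosedLoopSolution_of_forall_lt
          (a₀.2.1.solution.pos.trans_le (hle a₀ ha₀)) fun τ _ hτω => ?_
        obtain ⟨a, ha'⟩ := lt_iSup_iff.1 hτω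
        obtain ⟨ha, hτa⟩ := lt_iSup_iff.1 ha'
        exact ⟨a.1.1, a.1.2, a.2.1, hτa, hz a ha⟩
      have hr : ∀ a ∈ c, r a.1 (Ω, z) := fun a ha => ⟨hle a ha, hz a ha⟩
      exact ⟨⟨(Ω, z), hsol, rtrans a₀.2.2 (hr a₀ ha₀)⟩, hr⟩)
    (fun {a b c} hab hbc => rtrans hab hbc)
  refine ⟨M.1.1, M.1.2, M.2.2.1, M.2.2.2, M.2.1, fun ω' z hz hzM => ?_⟩
  by_contra! hlt
  have hr : r M.1 (ω', z) := ⟨hlt.le, hzM⟩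
  exact absurd (hM ⟨(ω', z), hz, rtrans M.2.2 hr⟩ hr).1 (not_le.2 hlt)

theorem eq_top_of_maximal (H : IsFunnelProblem σ d F T y₀ D β N α ρ φ)
    (S : IsMaximalClosedLoopSolution σ d F T y₀ D β N α ρ φ ω y) : ω = ⊤ := by
  have hpos := S.isSolution.solution.pos
  induction ω with
  | bot => exact absurd hpos (by simp)
  | top => rfl
  | coe t₀ =>
    obtain ⟨t₁, ht₁, Y, hY, hYy⟩ := H.exists_extension S.isSolution
    have h1 := S.maximal t₁ Y hY fun t h1 h2 => hYy t h1 (EReal.coe_lt_coe_iff.1 h2)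
    exact absurd (EReal.coe_le_coe_iff.1 h1) (not_le.2 ht₁)

/-! ### Boundedness of the signals -/

theorem memLp_comp_of_norm_le {V : Type*} [NormedAddCommGroup V] {w : ℝ → E m} {r : ℝ}
    (hr : r < 1) (hw : ContinuousOn w (Ici 0)) (hwr : ∀ t, 0 ≤ t → ‖w t‖ ≤ r) {g : E m → V}
    (hg : ContinuousOn g (Metric.ball 0 1)) : MemLp (fun t => g (w t)) ⊤ volPos := by
  obtain ⟨C, hC⟩ := (isCompact_closedBall (0 : E m) r).exists_bound_of_continuousOn
    (hg.mono (Metric.closedBall_subset_ball hr))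
  refine memLp_top_of_bound ((hg.comp hw fun t ht => mem_ball_zero_iff.2
    ((hwr t ht).trans_lt hr)).aestronglyMeasurable measurableSet_Ici) C ?_
  filter_upwards [ae_restrict_mem measurableSet_Ici] with t ht
  exact hC _ (mem_closedBall_zero_iff.2 (hwr t ht))

theorem continuousOn_of_global (H : IsFunnelProblem σ d F T y₀ D β N α ρ φ)
    (S : IsClosedLoopSolution σ d F T y₀ D β N α ρ φ ⊤ y) : ContinuousOn y (Ici (-σ)) := by
  intro t ht
  have hpos : (0 : ℝ) < max t 0 + 1 := by positivity
  have h1 := H.continuousOn_solution S hpos (EReal.coe_lt_top _) t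
    ⟨ht, (le_max_left t 0).trans (by linarith)⟩
  refine h1.mono_of_mem_nhdsWithin ?_
  have h2 : Iio (max t 0 + 1) ∈ 𝓝 t := Iio_mem_nhds (by linarith [le_max_left t 0])
  filter_upwards [self_mem_nhdsWithin, mem_nhdsWithin_of_mem_nhds h2] with s hs1 hs2
  exact ⟨hs1, le_of_lt hs2⟩

theorem memLp_operator (H : IsFunnelProblem σ d F T y₀ D β N α ρ φ)
    (S : IsClosedLoopSolution σ d F T y₀ D β N α ρ φ ⊤ y) : MemLp (T y) ⊤ volPos := by
  obtain ⟨R, hR⟩ := H.exists_operator_bound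
  have hy := H.continuousOn_of_global S
  have hunion : Ici (0 : ℝ) = ⋃ n : ℕ, Icc 0 (n : ℝ) := by
    ext t
    simp only [mem_Ici, mem_iUnion, mem_Icc, exists_and_left, iff_self_and]
    exact fun _ => exists_nat_ge t
  refine memLp_top_of_bound ?_ R ?_
  · rw [volPos, hunion, aestronglyMeasurable_iUnion_iff]
    exact fun n => (H.sys.operator.memLp_loc y hy n n.cast_nonneg).1
  · rw [volPos, ae_restrict_iff' measurableSet_Ici]
    filter_upwards [ae_of_forall_ae_restrict_Icc fun τ hτ hτω =>
      hR ⊤ y S τ hτ hτω y hy (eqOn_refl _ _)] with t ht h0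
    exact ht h0 (EReal.coe_lt_top t)

theorem signals_bounded (H : IsFunnelProblem σ d F T y₀ D β N α ρ φ)
    (S : IsClosedLoopSolution σ d F T y₀ D β N α ρ φ ⊤ y) :
    (MemLp y ⊤ (volume.restrict (Ici (-σ))) ∧
      MemLp (deriv y) ⊤ volPos ∧
      MemLp (funnelInput β N α ρ φ y) ⊤ volPos ∧
      MemLp (T y) ⊤ volPos ∧
      MemLp (fun t => α (‖normalizedError ρ φ y t‖ ^ 2)) ⊤ volPos ∧
      MemLp (fun t => N (α (‖normalizedError ρ φ y t‖ ^ 2))) ⊤ volPos) ∧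
    ∀ t : ℝ, 0 ≤ t → ‖y t - ρ t‖ < φ t := by
  obtain ⟨r, hr0, hr1, hbar⟩ := H.exists_barrier
  obtain ⟨L, hL⟩ := H.exists_lipschitz_bound
  obtain ⟨C, -, hC⟩ := H.exists_solution_bound
  have hy := H.continuousOn_of_global S
  have hw : ∀ t, 0 ≤ t → ‖normalizedError ρ φ y t‖ ≤ r := fun t ht =>
    hbar ⊤ y S t ht (EReal.coe_lt_top t)
  have hy0 : ContinuousOn y (Ici 0) :=
    hy.mono (Ici_subset_Ici.2 (by linarith [H.sys.memory_nonneg]))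
  have hwc : ContinuousOn (normalizedError ρ φ y) (Ici 0) :=
    (H.funnel.memW1Inf.continuousOn.inv₀ fun t ht => (H.funnel.pos ht).ne').smul
      (hy0.sub H.reference.continuousOn)
  have hsq : MapsTo (fun w : E m => ‖w‖ ^ 2) (Metric.ball 0 1) (Ico 0 1) := fun w hw =>
    ⟨sq_nonneg _, pow_lt_one₀ (norm_nonneg w) (mem_ball_zero_iff.1 hw) two_ne_zero⟩
  have hα : ContinuousOn (fun w : E m => α (‖w‖ ^ 2)) (Metric.ball 0 1) :=
    H.gain_continuousOn.comp (by fun_prop) hsq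
  have hN : ContinuousOn (fun w : E m => N (α (‖w‖ ^ 2))) (Metric.ball 0 1) :=
    H.switch_continuousOn.comp hα fun w hw =>
      mem_Ici.2 (zero_le_one.trans (H.gain_bijOn.mapsTo (hsq hw)))
  refine ⟨⟨?_, ?_, ?_, H.memLp_operator S, ?_, ?_⟩, fun t ht => ?_⟩
  · refine memLp_top_of_bound (hy.aestronglyMeasurable measurableSet_Ici) C ?_
    filter_upwards [ae_restrict_mem measurableSet_Ici] with t ht
    exact hC ⊤ y S t ht (EReal.coe_lt_top t)
  · refine memLp_top_of_bound (aestronglyMeasurable_deriv y _) L ?_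
    -- The point `0` is discarded: there the two-sided derivative also depends on the history, which
    -- need not be Lipschitz.
    rw [volPos, ← restrict_Ioi_eq_restrict_Ici]
    filter_upwards [ae_restrict_mem measurableSet_Ioi] with t ht
    refine norm_deriv_le_of_lipschitzOn (Ici_mem_nhds ht) ((hL ⊤ y S).mono fun s hs => ?_)
    exact ⟨hs, EReal.coe_lt_top s⟩
  · exact memLp_comp_of_norm_le hr1 hwc hw H.continuousOn_feedback
  · exact memLp_comp_of_norm_le hr1 hwc hw hα
  · exact memLp_comp_of_norm_le hr1 hwc hw hN
  · have h1 := (hw t ht).trans_lt hr1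
    rwa [norm_normalizedError H.funnel ht, div_lt_one (H.funnel.pos ht)] at h1

end IsFunnelProblem

end Proofs

end FunnelControl

theorem mainTheorem3 {p q m : ℕ} (σ : ℝ)
    (d : ℝ → E p)
    (F : E p × E q × E m → E m)
    (T : (ℝ → E m) → ℝ → E q)
    (hsys : SystemClass σ d F T)
    (y₀ : ℝ → E m) (hy₀ : ContinuousOn y₀ (Icc (-σ) 0))
    (D : ℝ → E m) (hD : MemLp D ⊤ volPos)
    (N : ℝ → ℝ) (hN : ContinuousOn N (Ici 0)) (hNsurj : SurjOn N (Ici 0) univ)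
    (α : ℝ → ℝ) (hα : ContinuousOn α (Ico 0 1)) (hαbij : BijOn α (Ico 0 1) (Ici 1))
    (βmax : ℝ) (hβmax : 0 < βmax)
    (β : ℝ → ℝ) (hβ : ContinuousOn β (Icc 0 1)) (hβmaps : MapsTo β (Icc 0 1) (Icc 0 βmax))
    (hβone : 0 < β 1)
    (ρ : ℝ → E m) (hρ : MemW1Inf ρ)
    (φ : ℝ → ℝ) (hφ : IsFunnelFunction φ)
    (hinit : ‖y₀ 0 - ρ 0‖ < φ 0) :
    -- the closed-loop initial value problem has a solution
    (∃ (ω : EReal) (y : ℝ → E m),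
      IsClosedLoopSolution σ d F T y₀ D β N α ρ φ ω y) ∧
    -- every solution can be extended to a maximal solution
    (∀ (ω : EReal) (y : ℝ → E m),
      IsClosedLoopSolution σ d F T y₀ D β N α ρ φ ω y →
      ∃ (ω' : EReal) (z : ℝ → E m), ω ≤ ω' ∧
        (∀ t : ℝ, -σ ≤ t → (t : EReal) < ω → z t = y t) ∧
        IsMaximalClosedLoopSolution σ d F T y₀ D β N α ρ φ ω' z) ∧
    -- every maximal solution is global, has bounded signals and evolves in the funnel
    (∀ (ω : EReal) (y : ℝ → E m),
      IsMaximalClosedLoopSolution σ d F T y₀ D β N α ρ φ ω y →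
      ω = ⊤ ∧
      (MemLp y ⊤ (volume.restrict (Ici (-σ))) ∧
        MemLp (deriv y) ⊤ volPos ∧
        MemLp (funnelInput β N α ρ φ y) ⊤ volPos ∧
        MemLp (T y) ⊤ volPos ∧
        MemLp (fun t => α (‖normalizedError ρ φ y t‖ ^ 2)) ⊤
          volPos ∧
        MemLp (fun t => N (α (‖normalizedError ρ φ y t‖ ^ 2))) ⊤
          volPos) ∧
      ∀ t : ℝ, 0 ≤ t → ‖y t - ρ t‖ < φ t) := by
  have H : IsFunnelProblem σ d F T y₀ D β N α ρ φ :=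
    ⟨hsys, hy₀, hD, hN, hNsurj, hα, hαbij, hβ, hβone, hρ, hφ, hinit⟩
  refine ⟨H.exists_closedLoopSolution, fun ω y S => H.exists_maximal_extension S, fun ω y S => ?_⟩
  obtain rfl := H.eq_top_of_maximal S
  exact ⟨rfl, H.signals_bounded S.isSolution⟩
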